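/- **Model.** Orders reach a restaurant in a Poisson process of rate $1$. They are prepared one at a time, first come first served, with independent exponential service times of rate $\mu>1$. Prepared orders wait for riders, first come first served. The platform gets no information from the restaurant and calls riders in an independent Poisson process of constant rate $\lambda_0$, where $1<\lambda_0\le\Lambda$; a call is dropped if $d$ riders are already waiting at the restaurant ($d\in\{0,1,2,\dots\}$ is the buffer). A rider who is called arrives at once, takes the earliest prepared order that waits, and otherwise waits in line, first come first served, for the next prepared order. The waiting time of an order runs from its placement until a rider fetches it, and that of a rider from the arrival at the restaurant until fetching an order. Let $\mathbb E_{\lambda_0,d}[T_o]$ and $\mathbb E_{\lambda_0,d}[T_r]$ be the almost sure long-run averages of the waiting times of the orders and of the (actually sent) riders, for a system that starts empty. Fix $\mu>1$, $\Lambda>1$ and a patience time $T^*>0$. A pair $(\lambda_0,d)$ is *feasible* if $1<\lambda_0\le\Lambda$ and $\mathbb E_{\lambda_0,d}[T_o]\le\frac1{\mu-1}+T^*$; it is *optimal* if it is feasible and minimizes $\mathbb E_{\lambda_0,d}[T_r]$ among all feasible pairs. For $\rho\in[0,1)$ let $D(\rho)$ be the smallest integer $n\ge0$ with $\frac{\rho^{n+1}}{1-\rho}\le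 T^*$, and for an integer $n\ge 0$ let $\gamma(n)$ be the largest $x\in(0,1)$ with $\frac{x^{n+1}}{1-x}\le T^*$. Put $d_1=D(1/\Lambda)$. **Algorithm.** If $\frac{1/\Lambda}{1-1/\Lambda}=\frac1{\Lambda-1}\le T^*$, return $(\lambda_0,d)=(\Lambda,0)$; otherwise return $(\lambda_0,d)=(1/\gamma(d_1),d_1)$. **Theorem.** The long-run averages $\mathbb E_{\lambda_0,d}[T_o]$ and $\mathbb E_{\lambda_0,d}[T_r]$ exist for all $\lambda_0>1$ and $d\ge0$. The minimum $D(1/\Lambda)$ and the maxima $\gamma(n)$, $n\ge 0$, exist. 1. The pair $(1/\gamma(d_1),d_1)$ satisfies $\mathbb E[T_o]=\frac1{\mu-1}+T^*$ and is optimal. Moreover $d_1$ is the smallest $d$ for which some $(\lambda_0,d)$ is feasible, and $\gamma(d_1)$ is the largest $\rho$ for which $(1/\rho,d_1)$ is feasible. 2. The pair $(\lambda_0,d)$ returned by the algorithm is optimal, and $d=d_1$. If $T^*\le\frac1{\Lambda-1}$, it satisfies $\mathbb E[T_o]=\frac1{\mu-1}+T^*$. If $T^*<\frac1{\Lambda-1}$,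 then $\lambda_0=1/\gamma(d_1)$. If $\frac1{\Lambda-1}\le T^*$, then the pair is $(\Lambda,0)$, with $\mathbb E[T_o]=\frac1{\mu-1}+\frac1{\Lambda-1}$ and $\mathbb E[T_r]=0$. -/

import Mathlib

open MeasureTheory ProbabilityTheory Filter Topology

namespace MealDelivery

/-- The three independent sources of randomness: arrivals of orders, the kitchen's services, and
the platform's calls for riders. -/
inductive Source
  | order
  | kitchen
  | rider

/-- A sample point: for each source, an infinite sequence of nonnegative clock durations, measured
in units of their mean. -/
abbrev Sample : Type := Source × ℕ → ℝ

instance isProbabilityMeasure_unitExp : IsProbabilityMeasure (expMeasure 1) :=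
  isProbabilityMeasure_expMeasure one_pos

/-- The law under which all the durations are independent exponential variables of rate `1`.
Dividing one of them by a rate `r > 0` gives an exponential variable of rate `r`. -/
noncomputable def sampleLaw : Measure Sample :=
  Measure.infinitePi fun _ : Source × ℕ => expMeasure 1

/-- Arrival time of order `n` (`n = 0, 1, …`): orders form a Poisson process of rate `1`. -/
noncomputable def orderTime (ω : Sample) (n : ℕ) : ℝ :=
  ∑ i ∈ Finset.range (n + 1), ω (Source.order, i)

/-- The time at which order `n` is prepared: the kitchen handles one order at a time, first come
first served, with independent exponential service times of rate `μ`. It starts empty. -/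
noncomputable def readyTime (μ : ℝ) (ω : Sample) : ℕ → ℝ
  | 0 => orderTime ω 0 + ω (Source.kitchen, 0) / μ
  | n + 1 => max (orderTime ω (n + 1)) (readyTime μ ω n) + ω (Source.kitchen, n + 1) / μ

/-- The number of orders prepared by time `t`. -/
noncomputable def readyCount (μ : ℝ) (ω : Sample) (t : ℝ) : ℕ :=
  {n : ℕ | readyTime μ ω n ≤ t}.ncard

/-- The time of the `k`-th epoch of the platform's dispatch clock, a Poisson process of constant
rate `lam` (`= λ₀`; without restaurant information the signal is always `0`). -/
noncomputable def callTime (lam : ℝ) (ω : Sample) (k : ℕ) : ℝ :=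
  ∑ i ∈ Finset.range (k + 1), ω (Source.rider, i) / lam

/-- The number of riders sent at the first `k` epochs of the dispatch clock. At an epoch a rider is
sent, and is immediately at the restaurant, unless `d` riders are already waiting there. In terms
of `Q₂ = (prepared orders) - (riders sent)`, which is the number of prepared orders that wait for a
rider, or minus the number of riders that wait for an order, this means `-d < Q₂`. -/
noncomputable def sentCount (μ lam : ℝ) (d : ℕ) (ω : Sample) : ℕ → ℕ
  | 0 => 0
  | k + 1 =>
      if -(d : ℤ) < (readyCount μ ω (callTime lam ω k) : ℤ) - (sentCount μ lam d ω k : ℤ) then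
        sentCount μ lam d ω k + 1
      else sentCount μ lam d ω k

/-- Arrival time at the restaurant of rider `n` (`n = 0, 1, …`), counting only the riders that are
actually sent. -/
noncomputable def riderTime (μ lam : ℝ) (d : ℕ) (ω : Sample) (n : ℕ) : ℝ :=
  callTime lam ω (sInf {k : ℕ | n < sentCount μ lam d ω (k + 1)})

/-- The time at which order `n` is fetched. Both waiting lines are first come first served, so
rider `n` takes order `n`, as soon as both are there. -/
noncomputable def fetchTime (μ lam : ℝ) (d : ℕ) (ω : Sample) (n : ℕ) : ℝ :=
  max (readyTime μ ω n) (riderTime μ lam d ω n)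

/-- Waiting time of order `n`, from its placement until a rider fetches it. -/
noncomputable def orderWait (μ lam : ℝ) (d : ℕ) (ω : Sample) (n : ℕ) : ℝ :=
  fetchTime μ lam d ω n - orderTime ω n

/-- Waiting time of rider `n` at the restaurant. -/
noncomputable def riderWait (μ lam : ℝ) (d : ℕ) (ω : Sample) (n : ℕ) : ℝ :=
  fetchTime μ lam d ω n - riderTime μ lam d ω n

/-- `v` is the mean order waiting time: almost surely, the waiting times of the successive orders
have long-run average `v`. -/
def IsMeanOrderWait (μ lam : ℝ) (d : ℕ) (v : ℝ) : Prop :=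
  ∀ᵐ ω ∂sampleLaw,
    Tendsto (fun n : ℕ => (∑ k ∈ Finset.range n, orderWait μ lam d ω k) / (n : ℝ)) atTop (𝓝 v)

/-- `v` is the mean rider waiting time: almost surely, the waiting times of the successive riders
have long-run average `v`. -/
def IsMeanRiderWait (μ lam : ℝ) (d : ℕ) (v : ℝ) : Prop :=
  ∀ᵐ ω ∂sampleLaw,
    Tendsto (fun n : ℕ => (∑ k ∈ Finset.range n, riderWait μ lam d ω k) / (n : ℝ)) atTop (𝓝 v)

/-- `E[T_o]`: the value `v` with `IsMeanOrderWait μ lam d v` (arbitrary if there is none). -/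
noncomputable def meanOrderWait (μ lam : ℝ) (d : ℕ) : ℝ :=
  Classical.epsilon fun v => IsMeanOrderWait μ lam d v

/-- `E[T_r]`: the value `v` with `IsMeanRiderWait μ lam d v` (arbitrary if there is none). -/
noncomputable def meanRiderWait (μ lam : ℝ) (d : ℕ) : ℝ :=
  Classical.epsilon fun v => IsMeanRiderWait μ lam d v

/-- The pair `(λ₀, d)` is feasible: the dispatch rate is admissible, and the mean order waiting
time exceeds `1 / (μ - 1)` by at most the patience time `T`. -/
def Feasible (μ Λ T lam : ℝ) (d : ℕ) : Prop :=
  1 < lam ∧ lam ≤ Λ ∧ meanOrderWait μ lam d ≤ 1 / (μ - 1) + T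

/-- The pair `(λ₀, d)` is feasible and minimizes `E[T_r]` among all feasible pairs. -/
def Optimal (μ Λ T lam : ℝ) (d : ℕ) : Prop :=
  Feasible μ Λ T lam d ∧
    ∀ (lam' : ℝ) (d' : ℕ), Feasible μ Λ T lam' d' → meanRiderWait μ lam d ≤ meanRiderWait μ lam' d'

/-- The buffers `n` with `ρ ^ (n + 1) / (1 - ρ) ≤ T`. -/
def bufferSet (T ρ : ℝ) : Set ℕ := {n : ℕ | ρ ^ (n + 1) / (1 - ρ) ≤ T}

/-- `D(ρ)`, the smallest nonnegative integer with `ρ ^ (D(ρ) + 1) / (1 - ρ) ≤ T`. -/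
noncomputable def bufferD (T ρ : ℝ) : ℕ := sInf (bufferSet T ρ)

/-- The `x` in `(0, 1)` with `x ^ (n + 1) / (1 - x) ≤ T`. -/
def loadSet (T : ℝ) (n : ℕ) : Set ℝ := {x : ℝ | x ∈ Set.Ioo 0 1 ∧ x ^ (n + 1) / (1 - x) ≤ T}

/-- `γ(n)`, the largest `x` in `(0, 1)` with `x ^ (n + 1) / (1 - x) ≤ T`. -/
noncomputable def loadGamma (T : ℝ) (n : ℕ) : ℝ := sSup (loadSet T n)

open Classical in
/-- The dispatch algorithm; its output is the pair `(λ₀, d)`. -/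
noncomputable def dispatchAlgorithm (T Λ : ℝ) : ℝ × ℕ :=
  if (1 / Λ) / (1 - 1 / Λ) ≤ T then (Λ, 0)
  else (1 / loadGamma T (bufferD T (1 / Λ)), bufferD T (1 / Λ))

end MealDelivery

/-! The riders see a second single-server queue. Rider `d + m` is sent at the first unused call
epoch after order `m` is prepared, so `riderTime (m + d) - readyTime m` obeys the recursion of a
sojourn time: arrivals are the preparations, services are the overshoots of the call clock. Lack of
memory makes the overshoots independent exponentials of rate `λ₀`, independent of the kitchen
(`map_overshoots`). Burke's theorem (`map_departureGaps`) makes the preparations of a stationary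
kitchen a Poisson process of rate `1`. Hence the second queue is driven by two independent
exponential streams (`measurePreserving_dispatchGaps`). A kitchen that starts empty differs from the
stationary one only by an absolutely continuous change of the first sojourn time, which preserves
almost sure statements (`ae_sampleLaw_dispatchGaps`).

With `ρ = 1 / λ₀`, order `d + m` waits, once prepared, for the positive part of the `m`-th sojourn
time minus the next `d` preparation gaps. Its stationary mean is `ρ ^ (d + 1) / (1 - ρ)`
(`lintegral_excess`). The rider's wait is this positive part minus the signed difference, of mean `ρ
/ (1 - ρ) - d`. The long-run averages follow from a second moment argument: queues with different
initial states and the same streams coalesce, so covariances decay geometrically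
(`lintegral_excess_mul_laterExcess_le`). Monotonicity in the initial state then covers every start
(`ae_twoStreams_tendsto`).

It remains to minimize `∑ i < d, (1 - ρ ^ (i + 1))` subject to `ρ ^ (d + 1) / (1 - ρ) ≤ T`. For a
fixed buffer the sum decreases in `ρ`, so the largest load `γ(d)` is best. There the sum equals `T -
γ(d) / (1 - γ(d)) + d`, which is nondecreasing in `d` because `γ / (1 - γ)` grows by at most `1` per
unit of buffer (`loadGamma_succ_le`). So the smallest feasible buffer wins, and it is the one that
the smallest load `1 / Λ` permits. -/

namespace MealDelivery

/-! ### Exponential laws: tilting, lack of memory, and one step of Burke's theorem. -/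

section Exponential

open scoped ENNReal

instance isProbabilityMeasure_expMeasure_of_fact {r : ℝ} [hr : Fact (0 < r)] :
    IsProbabilityMeasure (expMeasure r) :=
  isProbabilityMeasure_expMeasure hr.out

lemma expMeasure_eq_withDensity (r : ℝ) :
    expMeasure r = volume.withDensity (exponentialPDF r) := rfl

@[fun_prop]
lemma measurable_exponentialPDF (r : ℝ) : Measurable (exponentialPDF r) :=
  (measurable_exponentialPDFReal r).ennreal_ofReal

lemma lintegral_expMeasure (r : ℝ) {f : ℝ → ℝ≥0∞} (hf : Measurable f) :
    ∫⁻ x, f x ∂expMeasure r = ∫⁻ x, exponentialPDF r x * f x := by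
  rw [expMeasure_eq_withDensity, lintegral_withDensity_eq_lintegral_mul _
    (measurable_exponentialPDF r) hf]
  rfl

lemma expMeasure_absolutelyContinuous {r : ℝ} : expMeasure r ≪ volume.restrict (Set.Ici 0) := by
  refine Measure.AbsolutelyContinuous.mk fun s hs h => ?_
  rw [Measure.restrict_apply hs] at h
  rw [expMeasure_eq_withDensity, withDensity_apply _ hs, ← lintegral_indicator hs]
  refine (lintegral_eq_zero_iff ((measurable_exponentialPDF r).indicator hs)).2 ?_
  have : ∀ᵐ x, x ∉ s ∩ Set.Ici (0 : ℝ) := measure_eq_zero_iff_ae_notMem.1 h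
  filter_upwards [this] with x hx
  by_cases h1 : x ∈ s
  · have : x < 0 := by
      by_contra h2
      exact hx ⟨h1, not_lt.1 h2⟩
    simp [h1, exponentialPDF_of_neg this]
  · simp [h1]

lemma ae_expMeasure_pos (r : ℝ) : ∀ᵐ x ∂expMeasure r, 0 < x := by
  refine expMeasure_absolutelyContinuous.ae_le ?_
  rw [← restrict_Ioi_eq_restrict_Ici]
  exact ae_restrict_mem measurableSet_Ioi

/-- This passes from the stationary first sojourn time to that of a system that starts empty. -/
lemma expMeasure_absolutelyContinuous_expMeasure {r s : ℝ} (hs : 0 < s) :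
    expMeasure r ≪ expMeasure s := by
  refine expMeasure_absolutelyContinuous.trans ?_
  rw [← restrict_Ioi_eq_restrict_Ici]
  refine Measure.AbsolutelyContinuous.mk fun t ht h => ?_
  rw [Measure.restrict_apply ht]
  rw [expMeasure_eq_withDensity, withDensity_apply _ ht, ← lintegral_indicator ht,
    lintegral_eq_zero_iff ((measurable_exponentialPDF s).indicator ht)] at h
  refine measure_eq_zero_iff_ae_notMem.2 ?_
  filter_upwards [h] with x hx hxt
  have h1 : 0 < exponentialPDF s x := ENNReal.ofReal_pos.2 (exponentialPDFReal_pos hs hxt.2)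
  simp [hxt.1] at hx
  exact h1.ne' hx

/-- Exponential tilting. -/
lemma lintegral_exp_mul_expMeasure {r t : ℝ} (hr : 0 < r) (ht : 0 < r + t) {f : ℝ → ℝ≥0∞}
    (hf : Measurable f) :
    ∫⁻ x, ENNReal.ofReal (Real.exp (-(t * x))) * f x ∂expMeasure r =
      ENNReal.ofReal (r / (r + t)) * ∫⁻ x, f x ∂expMeasure (r + t) := by
  rw [lintegral_expMeasure _ (by fun_prop), lintegral_expMeasure _ hf,
    ← lintegral_const_mul _ (by fun_prop)]
  congr 1
  ext x
  rw [← mul_assoc, ← mul_assoc]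
  congr 1
  rcases lt_or_ge x 0 with hx | hx
  · simp [exponentialPDF_of_neg hx]
  · rw [exponentialPDF_of_nonneg hx, exponentialPDF_of_nonneg hx, ← ENNReal.ofReal_mul (by positivity),
      ← ENNReal.ofReal_mul (by positivity), mul_assoc, ← Real.exp_add]
    congr 1
    rw [← mul_assoc, div_mul_cancel₀ _ ht.ne']
    congr 2
    ring

lemma lintegral_exp_expMeasure {r t : ℝ} (hr : 0 < r) (ht : 0 < r + t) :
    ∫⁻ x, ENNReal.ofReal (Real.exp (-(t * x))) ∂expMeasure r = ENNReal.ofReal (r / (r + t)) := by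
  have : Fact (0 < r + t) := ⟨ht⟩
  simpa using lintegral_exp_mul_expMeasure hr ht (f := fun _ => 1) measurable_const

/-- Lack of memory. -/
lemma lintegral_expMeasure_memoryless {r t : ℝ} (ht : 0 ≤ t) {f : ℝ → ℝ≥0∞}
    (hf : Measurable f) :
    ∫⁻ x, (Set.Ici t).indicator (fun x => f (x - t)) x ∂expMeasure r =
      ENNReal.ofReal (Real.exp (-(r * t))) * ∫⁻ x, f x ∂expMeasure r := by
  have hm : Measurable fun x => f (x - t) := hf.comp (measurable_id.sub_const t)
  rw [lintegral_expMeasure _ (hm.indicator measurableSet_Ici), lintegral_expMeasure _ hf,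
    ← lintegral_const_mul _ (by fun_prop),
    ← lintegral_add_right_eq_self _ t]
  congr 1
  ext x
  rw [← mul_assoc]
  rcases lt_or_ge x 0 with hx | hx
  · have : x + t ∉ Set.Ici t := by simpa using hx
    rw [Set.indicator_of_notMem this, exponentialPDF_of_neg hx]
    simp
  · have : x + t ∈ Set.Ici t := by simpa using hx
    rw [Set.indicator_of_mem this, exponentialPDF_of_nonneg hx,
      exponentialPDF_of_nonneg (by positivity), mul_comm (ENNReal.ofReal _) (ENNReal.ofReal _),
      ← ENNReal.ofReal_mul' (by positivity), mul_assoc, ← Real.exp_add]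
    congr 4
    all_goals ring

lemma expMeasure_Ici {r t : ℝ} (hr : 0 < r) (ht : 0 ≤ t) :
    expMeasure r (Set.Ici t) = ENNReal.ofReal (Real.exp (-(r * t))) := by
  have : Fact (0 < r) := ⟨hr⟩
  have := lintegral_expMeasure_memoryless (r := r) ht (f := fun _ => 1) measurable_const
  rw [lintegral_indicator measurableSet_Ici] at this
  simpa using this

lemma expMeasure_map_div {r : ℝ} (hr : 0 < r) :
    (expMeasure 1).map (fun x => x / r) = expMeasure r := by
  have : Fact (0 < r) := ⟨hr⟩
  have := Measure.isProbabilityMeasure_map (μ := expMeasure 1) (f := fun x => x / r)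
    (by fun_prop)
  refine Measure.ext_of_Ici _ _ fun t => ?_
  rw [Measure.map_apply (by fun_prop) measurableSet_Ici]
  have h1 : (fun x => x / r) ⁻¹' Set.Ici t = Set.Ici (t * r) := by
    ext x
    simp [le_div_iff₀ hr]
  rw [h1]
  rcases le_or_gt 0 t with ht | ht
  · rw [expMeasure_Ici one_pos (by positivity), expMeasure_Ici hr ht]
    congr 3; ring
  · have key : ∀ (q : ℝ) (hq : 0 < q) (u : ℝ), u < 0 → expMeasure q (Set.Ici u) = 1 := by
      intro q hq u hu
      have : Fact (0 < q) := ⟨hq⟩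
      rw [prob_compl_eq_zero_iff measurableSet_Ici |>.symm]
      refine measure_eq_zero_iff_ae_notMem.2 ?_
      filter_upwards [ae_expMeasure_pos q] with x hx
      simp only [Set.mem_compl_iff, Set.mem_Ici, not_not]
      linarith
    rw [key 1 one_pos _ (mul_neg_of_neg_of_pos ht hr), key r hr _ ht]

lemma lintegral_expMeasure_memoryless_Ioi {r t : ℝ} (ht : 0 ≤ t) {f : ℝ → ℝ≥0∞}
    (hf : Measurable f) :
    ∫⁻ x, (Set.Ioi t).indicator (fun x => f (x - t)) x ∂expMeasure r =
      ENNReal.ofReal (Real.exp (-(r * t))) * ∫⁻ x, f x ∂expMeasure r := by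
  have h := lintegral_expMeasure_memoryless (r := r) ht (hf.indicator (measurableSet_Ioi (a := 0)))
  have h1 : ∫⁻ x, (Set.Ioi 0).indicator f x ∂expMeasure r = ∫⁻ x, f x ∂expMeasure r := by
    refine lintegral_congr_ae ?_
    filter_upwards [ae_expMeasure_pos r] with x hx
    rw [Set.indicator_of_mem (show x ∈ Set.Ioi 0 from hx)]
  rw [← h1, ← h]
  refine lintegral_congr fun x => ?_
  simp only [Set.indicator, Set.mem_Ioi, Set.mem_Ici, sub_pos]
  split_ifs <;> first | rfl | (exfalso; linarith)

/-- The minimum of two independent exponential variables is independent of the excess of the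
larger one, which keeps its law. -/
lemma lintegral_expMeasure_prod_min {a θ : ℝ} (ha : 0 < a) (hθ : 0 < θ) {F : ℝ → ℝ → ℝ≥0∞}
    (hF : Measurable (Function.uncurry F)) :
    ∫⁻ x, ∫⁻ y, F x y ∂expMeasure a ∂expMeasure θ =
      ENNReal.ofReal (a / (a + θ)) *
        ∫⁻ x, ∫⁻ s, F (x + s) s ∂expMeasure (a + θ) ∂expMeasure θ +
      ENNReal.ofReal (θ / (θ + a)) *
        ∫⁻ y, ∫⁻ s, F s (y + s) ∂expMeasure (a + θ) ∂expMeasure a := by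
  have : Fact (0 < a) := ⟨ha⟩
  have : Fact (0 < θ) := ⟨hθ⟩
  have : Fact (0 < a + θ) := ⟨add_pos ha hθ⟩
  have hF' : Measurable fun p : ℝ × ℝ => F p.1 p.2 := hF
  have hS : MeasurableSet {p : ℝ × ℝ | p.2 ≤ p.1} := measurableSet_le measurable_snd measurable_fst
  have hS' : MeasurableSet {p : ℝ × ℝ | p.1 < p.2} := measurableSet_lt measurable_fst measurable_snd
  have m1 := hF'.indicator hS
  have m2 := hF'.indicator hS'
  have split : ∀ x, ∫⁻ y, F x y ∂expMeasure a =
      ∫⁻ y, {p : ℝ × ℝ | p.2 ≤ p.1}.indicator (fun p => F p.1 p.2) (x, y) ∂expMeasure a +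
      ∫⁻ y, {p : ℝ × ℝ | p.1 < p.2}.indicator (fun p => F p.1 p.2) (x, y) ∂expMeasure a := by
    intro x
    have m1x : Measurable fun y =>
        {p : ℝ × ℝ | p.2 ≤ p.1}.indicator (fun p => F p.1 p.2) (x, y) :=
      m1.comp measurable_prodMk_left
    rw [← lintegral_add_left m1x]
    refine lintegral_congr fun y => ?_
    rcases le_or_gt y x with h | h
    · simp [Set.indicator, h, not_lt.2 h]
    · simp [Set.indicator, h, not_le.2 h]
  simp_rw [split]
  rw [lintegral_add_left m1.lintegral_prod_right']
  congr 1
  · rw [lintegral_lintegral_swap (f := fun x y =>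
      {p : ℝ × ℝ | p.2 ≤ p.1}.indicator (fun p => F p.1 p.2) (x, y)) m1.aemeasurable]
    -- With the smaller variable `y` fixed, lack of memory of the larger one produces `exp (-θ y)`,
    -- and this factor tilts the law of `y` from rate `a` to rate `a + θ`.
    have e : ∀ y, 0 < y → ∫⁻ x, {p : ℝ × ℝ | p.2 ≤ p.1}.indicator (fun p => F p.1 p.2) (x, y)
        ∂expMeasure θ =
        ENNReal.ofReal (Real.exp (-(θ * y))) * ∫⁻ x, F (x + y) y ∂expMeasure θ := by
      intro y hy
      have m : Measurable fun x => F (x + y) y := by fun_prop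
      rw [← lintegral_expMeasure_memoryless hy.le m]
      refine lintegral_congr fun x => ?_
      simp [Set.indicator]
    rw [lintegral_congr_ae ((ae_expMeasure_pos a).mono e),
      lintegral_exp_mul_expMeasure ha (add_pos ha hθ)]
    · rw [lintegral_lintegral_swap]
      fun_prop
    · exact Measurable.lintegral_prod_right' (f := fun p : ℝ × ℝ => F (p.2 + p.1) p.1) (by fun_prop)
  · have e : ∀ x, 0 < x → ∫⁻ y, {p : ℝ × ℝ | p.1 < p.2}.indicator (fun p => F p.1 p.2) (x, y)
        ∂expMeasure a =
        ENNReal.ofReal (Real.exp (-(a * x))) * ∫⁻ y, F x (y + x) ∂expMeasure a := by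
      intro x hx
      have m : Measurable fun y => F x (y + x) := by fun_prop
      rw [← lintegral_expMeasure_memoryless_Ioi hx.le m]
      refine lintegral_congr fun y => ?_
      simp [Set.indicator]
    rw [lintegral_congr_ae ((ae_expMeasure_pos θ).mono e),
      lintegral_exp_mul_expMeasure hθ (add_pos hθ ha), add_comm θ a]
    · rw [lintegral_lintegral_swap]
      fun_prop
    · exact Measurable.lintegral_prod_right' (f := fun p : ℝ × ℝ => F p.1 (p.2 + p.1)) (by fun_prop)

/-- One step of the queue: the sojourn time of the next customer and the gap between the two
departures are independent and have the laws of the sojourn time and of the gap between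
arrivals. -/
lemma map_burke_step {a θ : ℝ} (ha : 0 < a) (hθ : 0 < θ) :
    ((expMeasure θ).prod ((expMeasure a).prod (expMeasure (a + θ)))).map
      (fun p : ℝ × ℝ × ℝ => (max (p.1 - p.2.1) 0 + p.2.2, max (p.2.1 - p.1) 0 + p.2.2)) =
    (expMeasure θ).prod (expMeasure a) := by
  have : Fact (0 < a) := ⟨ha⟩
  have : Fact (0 < θ) := ⟨hθ⟩
  have : Fact (0 < a + θ) := ⟨add_pos ha hθ⟩
  refine Measure.ext_of_lintegral _ fun F hF => ?_
  rw [lintegral_map hF (by fun_prop), lintegral_prod _ (by fun_prop),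
    lintegral_prod _ (by fun_prop)]
  set H : ℝ → ℝ → ℝ≥0∞ := fun x y => ∫⁻ s, F (x + s, y + s) ∂expMeasure (a + θ) with hH
  have hHm : Measurable (Function.uncurry H) := by
    apply Measurable.lintegral_prod_right'
      (f := fun p : (ℝ × ℝ) × ℝ => F (p.1.1 + p.2, p.1.2 + p.2))
    fun_prop
  have e1 : ∀ x : ℝ, ∫⁻ p : ℝ × ℝ, F (max (x - p.1) 0 + p.2, max (p.1 - x) 0 + p.2)
      ∂(expMeasure a).prod (expMeasure (a + θ)) =
      ∫⁻ y, H (max (x - y) 0) (max (y - x) 0) ∂expMeasure a := by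
    intro x
    rw [lintegral_prod _ (by fun_prop)]
  simp_rw [e1]
  -- Both sides are split by which variable is smaller. On the left the minimum cancels in the
  -- differences, and the fresh service time, of rate `a + θ`, takes the place that the minimum has
  -- on the right.
  rw [lintegral_expMeasure_prod_min ha hθ (F := fun x y => H (max (x - y) 0) (max (y - x) 0))
      (hHm.comp (by fun_prop : Measurable fun p : ℝ × ℝ => (max (p.1 - p.2) 0, max (p.2 - p.1) 0))),
    lintegral_expMeasure_prod_min ha hθ (F := fun x y => F (x, y)) (by exact hF)]
  congr 2
  · refine lintegral_congr_ae ?_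
    filter_upwards [ae_expMeasure_pos θ] with x hx
    simp [hx.le, hH]
  · refine lintegral_congr_ae ?_
    filter_upwards [ae_expMeasure_pos a] with x hx
    simp [hx.le, hH]

end Exponential

/-! ### Independent sequences, controlled systems, and streams of exponential gaps. -/

section Sequences

open scoped ENNReal

variable {X Y U : Type*} [MeasurableSpace X] [MeasurableSpace Y] [MeasurableSpace U]

lemma eq_infinitePi_nat {α : Measure Y} [IsProbabilityMeasure α] {ν : Measure (ℕ → Y)}
    (h : ∀ (n : ℕ) (t : ℕ → Set Y), (∀ i, MeasurableSet (t i)) →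
      ν {y | ∀ i < n, y i ∈ t i} = ∏ i ∈ Finset.range n, α (t i)) :
    ν = Measure.infinitePi fun _ => α := by
  classical
  refine Measure.eq_infinitePi _ fun s t ht => ?_
  set n := s.sup id + 1 with hn
  have hs : ∀ i ∈ s, i < n := fun i hi => Nat.lt_succ_of_le (Finset.le_sup (f := id) hi)
  have h1 := h n (fun i => if i ∈ s then t i else Set.univ) fun i => by
    split_ifs
    exacts [ht i, MeasurableSet.univ]
  have h2 : {y : ℕ → Y | ∀ i < n, y i ∈ (if i ∈ s then t i else Set.univ)} = Set.pi s t := by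
    ext y
    simp only [Set.mem_ofPred_eq, Set.mem_pi, Finset.mem_coe]
    constructor
    · intro H i hi
      simpa [hi] using H i (hs i hi)
    · intro H i _
      split_ifs with hi
      exacts [H i hi, Set.mem_univ _]
  rw [← h2, h1, ← Finset.prod_subset (s₁ := s) (fun i hi => Finset.mem_range.2 (hs i hi))]
  · exact Finset.prod_congr rfl fun i hi => by simp [hi]
  · intro i _ hi
    simp [hi]

lemma infinitePi_nat_apply (α : Measure Y) [IsProbabilityMeasure α] (n : ℕ) {t : ℕ → Set Y}
    (ht : ∀ i, MeasurableSet (t i)) :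
    Measure.infinitePi (fun _ : ℕ => α) {y | ∀ i < n, y i ∈ t i} =
      ∏ i ∈ Finset.range n, α (t i) := by
  rw [← Measure.infinitePi_pi (μ := fun _ : ℕ => α) (s := Finset.range n) fun i _ => ht i]
  congr 1
  ext y
  simp

/-- Outputs of a controlled system: the control `u` is updated by each output. -/
def outputs {X Y U : Type*} (b : U → X → X × Y) (upd : U → Y → U) (u : U) (x : X) : ℕ → Y
  | 0 => (b u x).2
  | n + 1 => outputs b upd (upd u (b u x).2) (b u x).1 n

lemma measurable_outputs {b : U → X → X × Y} (hb : Measurable (Function.uncurry b))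
    {upd : U → Y → U} (hupd : Measurable (Function.uncurry upd)) (n : ℕ) :
    Measurable fun p : U × X => outputs b upd p.1 p.2 n := by
  have hb' : Measurable fun p : U × X => b p.1 p.2 := hb
  have hupd' : Measurable fun p : U × Y => upd p.1 p.2 := hupd
  induction n with
  | zero => exact measurable_snd.comp hb'
  | succ n ih =>
    exact ih.comp ((hupd'.comp (measurable_fst.prodMk (measurable_snd.comp hb'))).prodMk
      (measurable_fst.comp hb'))

/-- If each step of a controlled system splits off an output of law `α`, independent of the new
state, whose law is that of the old state, then the outputs are independent. -/
lemma map_outputs {π : Measure X} [IsProbabilityMeasure π] {α : Measure Y}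
    [IsProbabilityMeasure α] {b : U → X → X × Y} (hb : Measurable (Function.uncurry b))
    (hπ : ∀ u, π.map (b u) = π.prod α)
    {upd : U → Y → U} (hupd : Measurable (Function.uncurry upd)) (u : U) :
    π.map (outputs b upd u) = Measure.infinitePi fun _ => α := by
  have hm : ∀ u, Measurable (outputs b upd u) := fun u =>
    measurable_pi_lambda _ fun n => (measurable_outputs hb hupd n).comp measurable_prodMk_left
  have hbu : ∀ u, Measurable (b u) := fun u => hb.comp measurable_prodMk_left
  -- The induction runs over all controls at once: given the first output, the new state still has
  -- law `π`, and only the control has changed.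
  have key : ∀ (n : ℕ) (t : ℕ → Set Y), (∀ i, MeasurableSet (t i)) → ∀ u,
      π {x | ∀ i < n, outputs b upd u x i ∈ t i} = ∏ i ∈ Finset.range n, α (t i) := by
    intro n
    induction n with
    | zero => intro t _ u; simp
    | succ n ih =>
      intro t ht u
      set A : Set (X × Y) :=
        {p | p.2 ∈ t 0 ∧ ∀ i < n, outputs b upd (upd u p.2) p.1 i ∈ t (i + 1)} with hA
      have hAm : MeasurableSet A := by
        have : {p : X × Y | ∀ i < n, outputs b upd (upd u p.2) p.1 i ∈ t (i + 1)} =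
            ⋂ i, ⋂ (_ : i < n),
              (fun p : X × Y => outputs b upd (upd u p.2) p.1 i) ⁻¹' t (i + 1) := by
          ext; simp
        refine MeasurableSet.inter (s₂ := {p : X × Y | ∀ i < n,
          outputs b upd (upd u p.2) p.1 i ∈ t (i + 1)}) (measurable_snd (ht 0)) ?_
        rw [this]
        refine MeasurableSet.iInter fun i => MeasurableSet.iInter fun _ => ?_
        refine ((measurable_outputs hb hupd i).comp (?_ : Measurable fun p : X × Y =>
          (upd u p.2, p.1))) (ht _)
        exact (hupd.comp (measurable_const.prodMk measurable_snd)).prodMk measurable_fst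
      have e : {x | ∀ i < n + 1, outputs b upd u x i ∈ t i} = b u ⁻¹' A := by
        ext x
        simp only [Set.mem_ofPred_eq, Set.mem_preimage, hA]
        constructor
        · intro H
          exact ⟨H 0 (Nat.succ_pos _), fun i hi => H (i + 1) (Nat.succ_lt_succ hi)⟩
        · rintro ⟨H0, H⟩ i hi
          cases i with
          | zero => exact H0
          | succ i => exact H i (Nat.lt_of_succ_lt_succ hi)
      rw [e, ← Measure.map_apply (hbu u) hAm, hπ, Measure.prod_apply_symm hAm]
      have e2 : ∀ y, π ((fun x => (x, y)) ⁻¹' A) =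
          (t 0).indicator (fun _ => ∏ i ∈ Finset.range n, α (t (i + 1))) y := by
        intro y
        by_cases hy : y ∈ t 0
        · rw [Set.indicator_of_mem hy, ← ih (fun i => t (i + 1)) (fun i => ht _) (upd u y)]
          congr 1
          ext x
          simp [hA, hy]
        · simp [hA, hy]
      simp_rw [e2]
      rw [lintegral_indicator_const (ht 0), Finset.prod_range_succ']
  refine eq_infinitePi_nat fun n t ht => ?_
  have : {y : ℕ → Y | ∀ i < n, y i ∈ t i} = ⋂ i, ⋂ (_ : i < n), (fun y => y i) ⁻¹' t i := by
    ext; simp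
  rw [Measure.map_apply (hm u)]
  · exact key n t ht u
  rw [this]
  exact MeasurableSet.iInter fun i => MeasurableSet.iInter fun _ => measurable_pi_apply i (ht i)

/-- Prepend a value to a sequence. -/
def consSeq {Y : Type*} (p : Y × (ℕ → Y)) : ℕ → Y
  | 0 => p.1
  | n + 1 => p.2 n

/-- Drop the first `k` terms of a sequence. -/
def dropSeq {Y : Type*} (k : ℕ) (z : ℕ → Y) : ℕ → Y := fun n => z (n + k)

@[fun_prop]
lemma measurable_consSeq : Measurable (consSeq : Y × (ℕ → Y) → ℕ → Y) := by
  refine measurable_pi_lambda _ fun n => ?_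
  cases n with
  | zero => exact measurable_fst
  | succ n => exact (measurable_pi_apply n).comp measurable_snd

@[fun_prop]
lemma measurable_dropSeq (k : ℕ) : Measurable (dropSeq k : (ℕ → Y) → ℕ → Y) :=
  measurable_pi_lambda _ fun n => measurable_pi_apply (n + k)

lemma dropSeq_dropSeq {Y : Type*} (j k : ℕ) (z : ℕ → Y) : dropSeq j (dropSeq k z) = dropSeq (j + k) z := by
  funext n
  simp [dropSeq, add_assoc]

lemma measurePreserving_consSeq (α : Measure Y) [IsProbabilityMeasure α] :
    MeasurePreserving consSeq (α.prod (Measure.infinitePi fun _ : ℕ => α))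
      (Measure.infinitePi fun _ : ℕ => α) := by
  refine ⟨measurable_consSeq, eq_infinitePi_nat fun n t ht => ?_⟩
  have hS : ∀ (n : ℕ) (t : ℕ → Set Y), (∀ i, MeasurableSet (t i)) →
      MeasurableSet {y : ℕ → Y | ∀ i < n, y i ∈ t i} := by
    intro n t ht
    have : {y : ℕ → Y | ∀ i < n, y i ∈ t i} = ⋂ i, ⋂ (_ : i < n), (fun y => y i) ⁻¹' t i := by
      ext; simp
    rw [this]
    exact MeasurableSet.iInter fun i => MeasurableSet.iInter fun _ => measurable_pi_apply i (ht i)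
  rw [Measure.map_apply measurable_consSeq (hS n t ht)]
  cases n with
  | zero => simp
  | succ n =>
    have : consSeq ⁻¹' {y : ℕ → Y | ∀ i < n + 1, y i ∈ t i} =
        t 0 ×ˢ {y : ℕ → Y | ∀ i < n, y i ∈ t (i + 1)} := by
      ext p
      simp only [Set.mem_preimage, Set.mem_ofPred_eq, Set.mem_prod]
      constructor
      · intro H
        exact ⟨H 0 (Nat.succ_pos _), fun i hi => H (i + 1) (Nat.succ_lt_succ hi)⟩
      · rintro ⟨H0, H⟩ i hi
        cases i with
        | zero => exact H0
        | succ i => exact H i (Nat.lt_of_succ_lt_succ hi)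
    rw [this, Measure.prod_prod, infinitePi_nat_apply _ _ fun i => ht _, Finset.prod_range_succ',
      mul_comm]

lemma measurePreserving_head_tail (α : Measure Y) [IsProbabilityMeasure α] :
    MeasurePreserving (fun z : ℕ → Y => (z 0, dropSeq 1 z)) (Measure.infinitePi fun _ : ℕ => α)
      (α.prod (Measure.infinitePi fun _ : ℕ => α)) := by
  have hm : Measurable fun z : ℕ → Y => (z 0, dropSeq 1 z) :=
    (measurable_pi_apply 0).prodMk (measurable_dropSeq 1)
  refine ⟨hm, ?_⟩
  conv_lhs => rw [← (measurePreserving_consSeq α).map_eq, Measure.map_map hm measurable_consSeq]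
  exact Measure.map_id

lemma measurePreserving_dropSeq (α : Measure Y) [IsProbabilityMeasure α] (k : ℕ) :
    MeasurePreserving (dropSeq k) (Measure.infinitePi fun _ : ℕ => α)
      (Measure.infinitePi fun _ : ℕ => α) :=
  ⟨measurable_dropSeq k, Measure.map_infinitePi_infinitePi_of_inj (P := fun _ : ℕ => α)
    (add_left_injective k)⟩

lemma lintegral_infinitePi_cons (α : Measure Y) [IsProbabilityMeasure α] {F : (ℕ → Y) → ℝ≥0∞}
    (hF : Measurable F) :
    ∫⁻ z, F z ∂(Measure.infinitePi fun _ : ℕ => α) =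
      ∫⁻ x, ∫⁻ z, F (consSeq (x, z)) ∂(Measure.infinitePi fun _ : ℕ => α) ∂α := by
  rw [← (measurePreserving_consSeq α).lintegral_comp hF, lintegral_prod _ (by fun_prop)]

lemma lintegral_infinitePi_prod_range (α : Measure Y) [IsProbabilityMeasure α] {g : Y → ℝ≥0∞}
    (hg : Measurable g) (m : ℕ) :
    ∫⁻ z, ∏ i ∈ Finset.range m, g (z i) ∂(Measure.infinitePi fun _ : ℕ => α) =
      (∫⁻ x, g x ∂α) ^ m := by
  induction m with
  | zero => simp
  | succ m ih =>
    rw [lintegral_infinitePi_cons α (by fun_prop)]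
    have : ∀ x, ∫⁻ z, ∏ i ∈ Finset.range (m + 1), g (consSeq (x, z) i)
        ∂(Measure.infinitePi fun _ : ℕ => α) = (∫⁻ x, g x ∂α) ^ m * g x := by
      intro x
      simp_rw [Finset.prod_range_succ', consSeq]
      rw [lintegral_mul_const _ (by fun_prop), ih]
    simp_rw [this]
    rw [lintegral_const_mul _ hg, pow_succ]

lemma ae_infinitePi_forall (α : Measure Y) [IsProbabilityMeasure α] {p : Y → Prop}
    (hp : ∀ᵐ y ∂α, p y) : ∀ᵐ z ∂(Measure.infinitePi fun _ : ℕ => α), ∀ n, p (z n) :=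
  ae_all_iff.2 fun n =>
    (measurePreserving_eval_infinitePi (fun _ : ℕ => α) n).quasiMeasurePreserving.ae hp

/-- The law of the gaps of a Poisson process of rate `r`. -/
noncomputable abbrev expStream (r : ℝ) : Measure (ℕ → ℝ) :=
  Measure.infinitePi fun _ : ℕ => expMeasure r

lemma ae_expStream_pos (r : ℝ) [Fact (0 < r)] : ∀ᵐ z ∂expStream r, ∀ n, 0 < z n :=
  ae_infinitePi_forall _ (ae_expMeasure_pos r)

lemma lintegral_ofReal_expMeasure {r : ℝ} (hr : 0 < r) :
    ∫⁻ x, ENNReal.ofReal x ∂expMeasure r = ENNReal.ofReal (1 / r) := by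
  rw [lintegral_expMeasure _ (by fun_prop)]
  -- Up to the factor `1 / r`, the size-biased exponential density is the gamma density of shape
  -- `2`.
  have h : ∀ x, exponentialPDF r x * ENNReal.ofReal x =
      ENNReal.ofReal (1 / r) * gammaPDF 2 r x := by
    intro x
    rcases lt_or_ge x 0 with hx | hx
    · simp [exponentialPDF_of_neg hx, gammaPDF_of_neg hx]
    · rw [exponentialPDF_of_nonneg hx, gammaPDF_of_nonneg hx, ← ENNReal.ofReal_mul (by positivity),
        ← ENNReal.ofReal_mul (by positivity)]
      congr 1
      have : Real.Gamma 2 = 1 := by simp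
      rw [this]
      norm_num
      field_simp
  simp_rw [h]
  rw [lintegral_const_mul _ (f := gammaPDF 2 r) (measurable_gammaPDFReal 2 r).ennreal_ofReal,
    lintegral_gammaPDF_eq_one two_pos hr, mul_one]

lemma integrable_id_expMeasure {r : ℝ} (hr : 0 < r) : Integrable (fun x => x) (expMeasure r) := by
  refine ⟨by fun_prop, ?_⟩
  rw [hasFiniteIntegral_iff_enorm]
  have : ∫⁻ x, ‖x‖ₑ ∂expMeasure r = ∫⁻ x, ENNReal.ofReal x ∂expMeasure r := by
    refine lintegral_congr_ae ?_
    filter_upwards [ae_expMeasure_pos r] with x hx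
    rw [Real.enorm_eq_ofReal hx.le]
  rw [this, lintegral_ofReal_expMeasure hr]
  exact ENNReal.ofReal_lt_top

lemma integral_id_expMeasure {r : ℝ} (hr : 0 < r) : ∫ x, x ∂expMeasure r = 1 / r := by
  rw [integral_eq_lintegral_of_nonneg_ae ((ae_expMeasure_pos r).mono fun x hx => hx.le)
    (by fun_prop), lintegral_ofReal_expMeasure hr, ENNReal.toReal_ofReal (by positivity)]

lemma ae_expStream_tendsto_average {r : ℝ} [hr : Fact (0 < r)] :
    ∀ᵐ z ∂expStream r,
      Tendsto (fun n : ℕ => (∑ i ∈ Finset.range n, z i) / (n : ℝ)) atTop (𝓝 (1 / r)) := by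
  have mp := fun i => measurePreserving_eval_infinitePi (fun _ : ℕ => expMeasure r) i
  have h := strong_law_ae_real (μ := expStream r) (fun i z => z i)
    ((mp 0).integrable_comp_of_integrable (integrable_id_expMeasure hr.out)) ?_ ?_
  · have e : ∫ z, z 0 ∂expStream r = 1 / r := by
      rw [← integral_id_expMeasure hr.out, ← (mp 0).map_eq,
        integral_map (mp 0).measurable.aemeasurable (by fun_prop)]
    simpa only [e] using h
  · intro i j hij
    exact (iIndepFun_infinitePi (P := fun _ : ℕ => expMeasure r) (X := fun _ x => x)
      fun _ => measurable_id).indepFun hij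
  · intro i
    refine ⟨(measurable_pi_apply i).aemeasurable, (measurable_pi_apply 0).aemeasurable, ?_⟩
    exact (mp i).map_eq.trans (mp 0).map_eq.symm

lemma ae_expStream_tendsto_sum {r : ℝ} [hr : Fact (0 < r)] :
    ∀ᵐ z ∂expStream r, Tendsto (fun n : ℕ => ∑ i ∈ Finset.range n, z i) atTop atTop := by
  filter_upwards [ae_expStream_tendsto_average (r := r)] with z hz
  have h := hz.pos_mul_atTop (one_div_pos.2 hr.out) tendsto_natCast_atTop_atTop
  refine h.congr' ?_
  filter_upwards [eventually_gt_atTop 0] with n hn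
  have : (n : ℝ) ≠ 0 := by positivity
  field_simp

end Sequences

/-! ### Restarting a Poisson process, and the overshoots over successive targets. -/

section Restart

open scoped ENNReal

/-- The first index at which the point process with gaps `g` has reached time `t`. -/
noncomputable def firstPassage (t : ℝ) (g : ℕ → ℝ) : ℕ :=
  sInf {k : ℕ | t ≤ ∑ i ∈ Finset.range (k + 1), g i}

/-- The gaps of the point process with gaps `g`, observed from time `t` on. -/
noncomputable def restart (t : ℝ) (g : ℕ → ℝ) : ℕ → ℝ :=
  consSeq (∑ i ∈ Finset.range (firstPassage t g + 1), g i - t, dropSeq (firstPassage t g + 1) g)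

lemma nat_sInf_eq {s : Set ℕ} {n : ℕ} (h : n ∈ s) (h' : ∀ m < n, m ∉ s) : sInf s = n := by
  refine le_antisymm (Nat.sInf_le h) ?_
  by_contra hlt
  exact h' _ (not_le.1 hlt) (Nat.sInf_mem ⟨n, h⟩)

lemma measurable_firstPassage : Measurable fun p : ℝ × (ℕ → ℝ) => firstPassage p.1 p.2 := by
  classical
  set P : ℝ × (ℕ → ℝ) → ℕ → Prop := fun p k =>
    p.1 ≤ ∑ i ∈ Finset.range (k + 1), p.2 i with hP
  have hPm : ∀ k, MeasurableSet {p | P p k} := fun k => by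
    refine measurableSet_le measurable_fst ?_
    fun_prop
  -- The second alternative makes the search total. It yields `0` when the level is never reached,
  -- in agreement with `sInf ∅ = 0`.
  set Q : ℝ × (ℕ → ℝ) → ℕ → Prop := fun p k => P p k ∨ ∀ j, ¬ P p j with hQ
  have hQe : ∀ p, ∃ k, Q p k := fun p => by
    by_cases h : ∃ k, P p k
    · exact ⟨h.choose, Or.inl h.choose_spec⟩
    · exact ⟨0, Or.inr (not_exists.1 h)⟩
  have hQm : ∀ k, MeasurableSet {p | Q p k} := fun k => by
    have : {p | Q p k} = {p | P p k} ∪ ⋂ j, {p | P p j}ᶜ := by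
      ext p; simp [hQ]
    rw [this]
    exact (hPm k).union (MeasurableSet.iInter fun j => (hPm j).compl)
  have e : (fun p : ℝ × (ℕ → ℝ) => firstPassage p.1 p.2) = fun p => Nat.find (hQe p) := by
    funext p
    by_cases h : ∃ k, P p k
    · have hs := Nat.find_spec (hQe p)
      refine nat_sInf_eq ?_ fun m hm hmem => ?_
      · rcases hs with hs | hs
        · exact hs
        · exact absurd h (not_exists.2 hs)
      · exact Nat.find_min (hQe p) hm (Or.inl hmem)
    · have h0 : Nat.find (hQe p) = 0 :=
        (Nat.find_eq_zero (hQe p)).2 (Or.inr (not_exists.1 h))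
      rw [h0]
      have : {k : ℕ | p.1 ≤ ∑ i ∈ Finset.range (k + 1), p.2 i} = ∅ := by
        ext k
        simpa [hP] using not_exists.1 h k
      simp only [firstPassage, this, Nat.sInf_empty]
  rw [e]
  exact measurable_find hQe hQm

lemma measurable_restart : Measurable fun p : ℝ × (ℕ → ℝ) => restart p.1 p.2 := by
  have h : Measurable fun q : ℕ × (ℝ × (ℕ → ℝ)) =>
      consSeq (∑ i ∈ Finset.range (q.1 + 1), q.2.2 i - q.2.1, dropSeq (q.1 + 1) q.2.2) := by
    refine measurable_from_prod_countable_right fun k => ?_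
    dsimp only
    fun_prop
  exact h.comp (measurable_firstPassage.prodMk measurable_id)

lemma measurable_restart_left (t : ℝ) : Measurable (restart t) := by
  have h : Measurable ((fun p : ℝ × (ℕ → ℝ) => restart p.1 p.2) ∘ Prod.mk t) :=
    measurable_restart.comp measurable_prodMk_left
  exact h

lemma firstPassage_mem {t : ℝ} {g : ℕ → ℝ}
    (h : ∃ k, t ≤ ∑ i ∈ Finset.range (k + 1), g i) :
    t ≤ ∑ i ∈ Finset.range (firstPassage t g + 1), g i :=
  Nat.sInf_mem (s := {k : ℕ | t ≤ ∑ i ∈ Finset.range (k + 1), g i}) h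

lemma sum_lt_of_lt_firstPassage {t : ℝ} {g : ℕ → ℝ} {k : ℕ} (h : k < firstPassage t g) :
    ∑ i ∈ Finset.range (k + 1), g i < t :=
  not_le.1 (Nat.notMem_of_lt_sInf (s := {k : ℕ | t ≤ ∑ i ∈ Finset.range (k + 1), g i}) h)

lemma firstPassage_eq {t : ℝ} {g : ℕ → ℝ} {k : ℕ} (h : t ≤ ∑ i ∈ Finset.range (k + 1), g i)
    (h' : ∀ j < k, ∑ i ∈ Finset.range (j + 1), g i < t) : firstPassage t g = k :=
  nat_sInf_eq h fun j hj => not_le.2 (h' j hj)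

lemma restart_consSeq_of_le {t x : ℝ} (g : ℕ → ℝ) (h : t ≤ x) :
    restart t (consSeq (x, g)) = consSeq (x - t, g) := by
  have : firstPassage t (consSeq (x, g)) = 0 := firstPassage_eq (by simpa [consSeq]) (by simp)
  rw [restart, this]
  congr 1
  simp [consSeq]
  rfl

/-- The existence hypothesis excludes the default `sInf ∅ = 0`, under which the two first passage
indices would not differ by one. -/
lemma restart_consSeq_of_lt {t x : ℝ} {g : ℕ → ℝ} (h : x < t)
    (hg : ∃ k, t - x ≤ ∑ i ∈ Finset.range (k + 1), g i) :
    restart t (consSeq (x, g)) = restart (t - x) g := by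
  have e : ∀ k, ∑ i ∈ Finset.range (k + 1), consSeq (x, g) i =
      ∑ i ∈ Finset.range k, g i + x := fun k => by
    rw [Finset.sum_range_succ']
    rfl
  have : firstPassage t (consSeq (x, g)) = firstPassage (t - x) g + 1 := by
    refine firstPassage_eq ?_ fun j hj => ?_
    · rw [e]
      linarith [firstPassage_mem hg]
    · rw [e]
      cases j with
      | zero => simpa using h
      | succ j => linarith [sum_lt_of_lt_firstPassage (Nat.lt_of_succ_lt_succ hj)]
  rw [restart, this, e, restart]
  congr 2
  ring

/-- Condition on the first gap. If it reaches `t`, lack of memory gives exactly the law of the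
stream; otherwise the induction continues with the remaining time. The error is the chance of `n`
gaps all shorter than `T`, where `T` bounds every remaining time and so keeps the ratio fixed. -/
lemma lintegral_restart_le {r : ℝ} [hr : Fact (0 < r)] {B : Set (ℕ → ℝ)} (hB : MeasurableSet B)
    (T : ℝ) (n : ℕ) : ∀ t : ℝ, 0 ≤ t → t ≤ T → expStream r (restart t ⁻¹' B) ≤
      expStream r B + (expMeasure r (Set.Iio T)) ^ n := by
  induction n with
  | zero => intro t _ _; exact prob_le_one.trans (by simp)
  | succ n ih =>
    intro t ht htT
    have hRm : ∀ t, Measurable (restart t) := measurable_restart_left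
    set I : (ℕ → ℝ) → ℝ≥0∞ := B.indicator 1 with hI
    have hIm : Measurable I := measurable_const.indicator hB
    have e0 : ∀ t, expStream r (restart t ⁻¹' B) = ∫⁻ g, I (restart t g) ∂expStream r := fun t => by
      rw [← lintegral_indicator_one (hRm t hB)]
      rfl
    set φ : ℝ → ℝ≥0∞ := fun x => ∫⁻ g, I (consSeq (x, g)) ∂expStream r with hφ
    have hφm : Measurable φ :=
      Measurable.lintegral_prod_right' (f := fun p : ℝ × (ℕ → ℝ) => I (consSeq p)) (by fun_prop)
    have hφi : ∫⁻ x, φ x ∂expMeasure r = expStream r B := by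
      rw [hφ, ← lintegral_infinitePi_cons _ hIm, lintegral_indicator_one hB]
    set c := expStream r B + (expMeasure r (Set.Iio T)) ^ n with hc
    have hle : ∀ᵐ x ∂expMeasure r, ∫⁻ g, I (restart t (consSeq (x, g))) ∂expStream r ≤
        (Set.Ici t).indicator (fun x => φ (x - t)) x + (Set.Iio t).indicator (fun _ => c) x := by
      filter_upwards [ae_expMeasure_pos r] with x hx
      rcases le_or_gt t x with h | h
      · rw [Set.indicator_of_mem (show x ∈ Set.Ici t from h)]
        simp_rw [restart_consSeq_of_le _ h]
        exact le_self_add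
      · rw [Set.indicator_of_mem (show x ∈ Set.Iio t from h)]
        refine le_trans ?_ le_add_self
        refine le_trans (le_of_eq ?_) (ih (t - x) (by linarith) (by linarith))
        rw [e0]
        refine lintegral_congr_ae ?_
        filter_upwards [ae_expStream_tendsto_sum (r := r)] with g hg
        rw [restart_consSeq_of_lt h]
        obtain ⟨k, hk⟩ := ((hg.comp (tendsto_add_atTop_nat 1)).eventually_ge_atTop (t - x)).exists
        exact ⟨k, hk⟩
    have h1 : expMeasure r (Set.Ici t) + expMeasure r (Set.Iio t) = 1 := by
      rw [← Set.compl_Ici, prob_add_prob_compl measurableSet_Ici]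
    rw [e0, lintegral_infinitePi_cons (expMeasure r) (F := fun g => I (restart t g))
      (hIm.comp (hRm t))]
    calc _ ≤ ∫⁻ x, ((Set.Ici t).indicator (fun x => φ (x - t)) x +
          (Set.Iio t).indicator (fun _ => c) x) ∂expMeasure r := lintegral_mono_ae hle
      _ = expMeasure r (Set.Ici t) * expStream r B + expMeasure r (Set.Iio t) * c := by
        rw [lintegral_add_right _ (measurable_const.indicator measurableSet_Iio),
          lintegral_expMeasure_memoryless ht hφm, hφi, expMeasure_Ici hr.out ht,
          lintegral_indicator_const measurableSet_Iio, mul_comm c]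
      _ = expStream r B + expMeasure r (Set.Iio t) * (expMeasure r (Set.Iio T)) ^ n := by
        rw [hc, mul_add, ← add_assoc, ← add_mul, h1, one_mul]
      _ ≤ _ := by
        rw [pow_succ']
        gcongr

/-- The strong Markov property of a Poisson process, at a fixed time. -/
lemma map_restart {r : ℝ} [hr : Fact (0 < r)] {t : ℝ} (ht : 0 ≤ t) :
    (expStream r).map (restart t) = expStream r := by
  have hRm : Measurable (restart t) := measurable_restart_left t
  have : IsProbabilityMeasure ((expStream r).map (restart t)) :=
    Measure.isProbabilityMeasure_map hRm.aemeasurable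
  have hq : expMeasure r (Set.Iio t) < 1 := by
    refine lt_of_le_of_ne prob_le_one fun h => ?_
    have h1 := prob_compl_eq_zero_iff (μ := expMeasure r) (measurableSet_Iio (a := t)) |>.2 h
    rw [Set.compl_Iio, expMeasure_Ici hr.out ht] at h1
    exact (ENNReal.ofReal_pos.2 (Real.exp_pos _)).ne' h1
  -- Between probability measures an inequality is an equality, so the one-sided estimate suffices.
  refine Measure.eq_of_le_of_isProbabilityMeasure (Measure.le_iff.2 fun B hB => ?_)
  rw [Measure.map_apply hRm hB]
  have hlim : Tendsto (fun n : ℕ => expStream r B + (expMeasure r (Set.Iio t)) ^ n) atTop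
      (𝓝 (expStream r B + 0)) :=
    (ENNReal.tendsto_pow_atTop_nhds_zero_of_lt_one hq).const_add _
  rw [add_zero] at hlim
  exact ge_of_tendsto' hlim fun n => lintegral_restart_le hB t n t ht le_rfl

/-- Wait for the first point after the target `p.1 0`, given that the time is `p.2`. -/
noncomputable def overshootStep (p : (ℕ → ℝ) × ℝ) (g : ℕ → ℝ) : (ℕ → ℝ) × ℝ :=
  (dropSeq 1 (restart (max (p.1 0 - p.2) 0) g), restart (max (p.1 0 - p.2) 0) g 0)

/-- Advance the time `p.2` to the first point after the target `p.1 0`. -/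
noncomputable def overshootUpdate (p : (ℕ → ℝ) × ℝ) (y : ℝ) : (ℕ → ℝ) × ℝ :=
  (dropSeq 1 p.1, max p.2 (p.1 0) + y)

/-- A clock with gaps `g` is used at successive times: each time at its first unused epoch that is
not before the next target. These are the times by which the epochs exceed both the target and the
preceding epoch. -/
noncomputable def overshoots (p : (ℕ → ℝ) × ℝ) (g : ℕ → ℝ) : ℕ → ℝ :=
  outputs overshootStep overshootUpdate p g

lemma measurable_overshootStep : Measurable (Function.uncurry overshootStep) := by
  have h : Measurable fun q : ((ℕ → ℝ) × ℝ) × (ℕ → ℝ) =>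
      restart (max (q.1.1 0 - q.1.2) 0) q.2 := by
    have h' : Measurable fun q : ((ℕ → ℝ) × ℝ) × (ℕ → ℝ) => (max (q.1.1 0 - q.1.2) 0, q.2) := by
      fun_prop
    have h'' := measurable_restart.comp h'
    exact h''
  exact ((measurable_dropSeq 1).comp h).prodMk ((measurable_pi_apply 0).comp h)

lemma measurable_overshootUpdate : Measurable (Function.uncurry overshootUpdate) := by
  unfold overshootUpdate Function.uncurry
  fun_prop

lemma measurable_overshoots :
    Measurable fun q : ((ℕ → ℝ) × ℝ) × (ℕ → ℝ) => overshoots q.1 q.2 :=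
  measurable_pi_lambda _ fun n =>
    measurable_outputs measurable_overshootStep measurable_overshootUpdate n

/-- The state is the unused part of the clock; the control is the list of remaining targets with the
current time. Restarting at any fixed time preserves the law of the clock, so the law of the
overshoots does not depend on the targets. -/
lemma map_overshoots {r : ℝ} [Fact (0 < r)] (p : (ℕ → ℝ) × ℝ) :
    (expStream r).map (overshoots p) = expStream r := by
  refine map_outputs measurable_overshootStep (fun u => ?_) measurable_overshootUpdate p
  have hR : MeasurePreserving (restart (max (u.1 0 - u.2) 0)) (expStream r) (expStream r) :=
    ⟨measurable_restart_left _, map_restart (le_max_right _ _)⟩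
  exact ((Measure.measurePreserving_swap.comp
    (measurePreserving_head_tail (expMeasure r))).comp hR).map_eq

end Restart

/-! ### The stationary single-server queue and Burke's theorem. -/

section Queue

variable {X X' : Type*} [MeasurableSpace X] [MeasurableSpace X']

/-- Two independent Poisson processes. -/
noncomputable abbrev twoStreams (a s : ℝ) : Measure ((ℕ → ℝ) × (ℕ → ℝ)) :=
  (expStream a).prod (expStream s)

lemma measurePreserving_twoStreams_split (a s : ℝ) [Fact (0 < a)] [Fact (0 < s)] :
    MeasurePreserving (fun z : (ℕ → ℝ) × (ℕ → ℝ) =>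
        ((z.1 0, z.2 0), (dropSeq 1 z.1, dropSeq 1 z.2)))
      (twoStreams a s) (((expMeasure a).prod (expMeasure s)).prod (twoStreams a s)) := by
  have h := (measurePreserving_head_tail (expMeasure a)).prod
    (measurePreserving_head_tail (expMeasure s))
  have h2 : MeasurePreserving (fun p : (ℝ × (ℕ → ℝ)) × (ℝ × (ℕ → ℝ)) =>
      ((p.1.1, p.2.1), (p.1.2, p.2.2)))
      (((expMeasure a).prod (expStream a)).prod ((expMeasure s).prod (expStream s)))
      (((expMeasure a).prod (expMeasure s)).prod (twoStreams a s)) := by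
    refine ⟨by fun_prop, Measure.ext_of_lintegral _ fun F hF => ?_⟩
    rw [lintegral_map hF (by fun_prop), lintegral_prod _ (by fun_prop),
      lintegral_prod _ (by fun_prop), lintegral_prod _ (by fun_prop), lintegral_prod _ (by fun_prop)]
    refine lintegral_congr fun x => ?_
    have e1 : ∀ A : ℕ → ℝ, ∫⁻ q : ℝ × (ℕ → ℝ), F ((x, q.1), (A, q.2))
        ∂(expMeasure s).prod (expStream s) =
        ∫⁻ y, ∫⁻ S, F ((x, y), (A, S)) ∂expStream s ∂expMeasure s := fun A =>
      lintegral_prod _ (by fun_prop)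
    have e2 : ∀ y : ℝ, ∫⁻ q : (ℕ → ℝ) × (ℕ → ℝ), F ((x, y), q) ∂twoStreams a s =
        ∫⁻ A, ∫⁻ S, F ((x, y), (A, S)) ∂expStream s ∂expStream a := fun y =>
      lintegral_prod _ (by fun_prop)
    simp_rw [e1, e2]
    rw [lintegral_lintegral_swap]
    exact (Measurable.lintegral_prod_right' (f := fun p : ((ℕ → ℝ) × ℝ) × (ℕ → ℝ) =>
      F ((x, p.1.2), (p.1.1, p.2))) (by fun_prop)).aemeasurable
  exact h2.comp h

/-- The engine of every recursion that consumes the heads of two streams: the tails are again two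
independent streams, independent of the updated state. -/
lemma measurePreserving_twoStreams_step {a s : ℝ} [Fact (0 < a)] [Fact (0 < s)]
    (κ : Measure X) [IsProbabilityMeasure κ] {st : X × (ℝ × ℝ) → X'} (hst : Measurable st) :
    MeasurePreserving (fun p : X × ((ℕ → ℝ) × (ℕ → ℝ)) =>
        (st (p.1, (p.2.1 0, p.2.2 0)), (dropSeq 1 p.2.1, dropSeq 1 p.2.2)))
      (κ.prod (twoStreams a s))
      (((κ.prod ((expMeasure a).prod (expMeasure s))).map st).prod (twoStreams a s)) := by
  have h1 := (MeasurePreserving.id κ).prod (measurePreserving_twoStreams_split a s)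
  have h2 := (measurePreserving_prodAssoc κ ((expMeasure a).prod (expMeasure s))
    (twoStreams a s)).symm
  have : IsProbabilityMeasure ((κ.prod ((expMeasure a).prod (expMeasure s))).map st) :=
    Measure.isProbabilityMeasure_map hst.aemeasurable
  have h3 : MeasurePreserving st (κ.prod ((expMeasure a).prod (expMeasure s)))
      ((κ.prod ((expMeasure a).prod (expMeasure s))).map st) := ⟨hst, rfl⟩
  exact (h3.prod (MeasurePreserving.id (twoStreams a s))).comp (h2.comp h1)

/-- The state space of the queue: the current sojourn time, and the future gaps between arrivals
and service times. -/
abbrev QueueState : Type := ℝ × ((ℕ → ℝ) × (ℕ → ℝ))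

/-- One step of the queue, together with the gap between two departures. -/
noncomputable def queueStep (_ : Unit) (p : QueueState) : QueueState × ℝ :=
  ((max (p.1 - p.2.1 0) 0 + p.2.2 0, (dropSeq 1 p.2.1, dropSeq 1 p.2.2)),
    max (p.2.1 0 - p.1) 0 + p.2.2 0)

lemma measurable_queueStep : Measurable (Function.uncurry queueStep) := by
  unfold queueStep Function.uncurry
  fun_prop

/-- Here `θ` is the service rate minus the arrival rate, the rate of the stationary sojourn time.
The product form on the right combines stationarity with the independence of the departure gap from
the new state, which is what `map_outputs` requires. -/
lemma map_queueStep {a θ : ℝ} [ha : Fact (0 < a)] [hθ : Fact (0 < θ)] [Fact (0 < a + θ)]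
    (u : Unit) :
    ((expMeasure θ).prod (twoStreams a (a + θ))).map (queueStep u) =
      ((expMeasure θ).prod (twoStreams a (a + θ))).prod (expMeasure a) := by
  have h := measurePreserving_twoStreams_step (a := a) (s := a + θ) (expMeasure θ)
    (st := fun p : ℝ × ℝ × ℝ => (max (p.1 - p.2.1) 0 + p.2.2, max (p.2.1 - p.1) 0 + p.2.2))
    (by fun_prop)
  rw [map_burke_step ha.out hθ.out] at h
  have h1 := measurePreserving_prodAssoc (expMeasure θ) (expMeasure a) (twoStreams a (a + θ))
  have h2 := (MeasurePreserving.id (expMeasure θ)).prod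
    (Measure.measurePreserving_swap (μ := expMeasure a) (ν := twoStreams a (a + θ)))
  have h3 := (measurePreserving_prodAssoc (expMeasure θ) (twoStreams a (a + θ))
    (expMeasure a)).symm
  exact (h3.comp (h2.comp (h1.comp h))).map_eq

/-- The gaps between the departures from a queue. -/
noncomputable def departureGaps (p : QueueState) : ℕ → ℝ :=
  outputs queueStep (fun _ _ => ()) () p

lemma measurable_departureGaps : Measurable departureGaps :=
  measurable_pi_lambda _ fun n =>
    (measurable_outputs measurable_queueStep measurable_const n).comp
      (measurable_const.prodMk measurable_id)

/-- Burke's theorem. -/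
lemma map_departureGaps {a θ : ℝ} [Fact (0 < a)] [Fact (0 < θ)] [Fact (0 < a + θ)] :
    ((expMeasure θ).prod (twoStreams a (a + θ))).map departureGaps = expStream a :=
  map_outputs measurable_queueStep map_queueStep measurable_const ()

end Queue

/-! ### A law of large numbers from decaying covariances. -/

section Averages

open scoped ENNReal

variable {Ω : Type*} [MeasurableSpace Ω] {P : Measure Ω}

/-- Partial sums of nonnegative terms are monotone and consecutive squares have ratio tending to
`1`, so convergence along the squares interpolates. -/
lemma tendsto_average_of_squares {u : ℕ → ℝ} {c : ℝ} (hu : ∀ n, 0 ≤ u n)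
    (h : Tendsto (fun k : ℕ => (∑ i ∈ Finset.range ((k + 1) ^ 2), u i) / (((k + 1) ^ 2 : ℕ) : ℝ))
      atTop (𝓝 c)) :
    Tendsto (fun n : ℕ => (∑ i ∈ Finset.range n, u i) / (n : ℝ)) atTop (𝓝 c) := by
  refine tendsto_div_of_monotone_of_exists_subseq_tendsto_div
    (fun n => ∑ i ∈ Finset.range n, u i) c ?_ ?_
  · exact monotone_nat_of_le_succ fun n => by
      simp only [Finset.sum_range_succ]
      linarith [hu n]
  · intro a ha
    refine ⟨fun k => (k + 1) ^ 2, ?_, ?_, h⟩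
    · have h1 : Tendsto (fun k : ℕ => (1 + 1 / ((k : ℝ) + 1)) ^ 2) atTop (𝓝 ((1 + 0) ^ 2)) :=
        (tendsto_one_div_add_atTop_nhds_zero_nat.const_add 1).pow 2
      have h2 : ∀ᶠ k : ℕ in atTop, (1 + 1 / ((k : ℝ) + 1)) ^ 2 < a :=
        h1.eventually (gt_mem_nhds (by linarith))
      filter_upwards [h2] with k hk
      have hk1 : (0 : ℝ) < k + 1 := by positivity
      have : (((k + 1 + 1) ^ 2 : ℕ) : ℝ) = (1 + 1 / ((k : ℝ) + 1)) ^ 2 * (((k + 1) ^ 2 : ℕ) : ℝ) := by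
        push_cast
        field_simp
      rw [this]
      exact mul_le_mul_of_nonneg_right hk.le (by positivity)
    · exact (tendsto_pow_atTop two_ne_zero).comp (tendsto_add_atTop_nat 1)

/-- A strong law of large numbers for nonnegative variables with geometrically decaying upper
bounds on the covariances. -/
lemma ae_tendsto_average_of_covariance [IsProbabilityMeasure P] {X : ℕ → Ω → ℝ}
    (hX : ∀ n, Measurable (X n)) (hX0 : ∀ n ω, 0 ≤ X n ω) {c K q : ℝ} (hc : 0 ≤ c) (hK : 0 ≤ K)
    (hq : 0 ≤ q) (hq1 : q < 1)
    (hmean : ∀ n, ∫⁻ ω, ENNReal.ofReal (X n ω) ∂P = ENNReal.ofReal c)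
    (hcov : ∀ i m, ∫⁻ ω, ENNReal.ofReal (X i ω) * ENNReal.ofReal (X (i + m) ω) ∂P ≤
      ENNReal.ofReal (c ^ 2 + K * q ^ m)) :
    ∀ᵐ ω ∂P, Tendsto (fun n : ℕ => (∑ i ∈ Finset.range n, X i ω) / (n : ℝ)) atTop (𝓝 c) := by
  have i1 : ∀ n, Integrable (X n) P := fun n => by
    refine (lintegral_ofReal_ne_top_iff_integrable (hX n).aestronglyMeasurable
      (ae_of_all _ (hX0 n))).1 ?_
    rw [hmean]
    exact ENNReal.ofReal_ne_top
  have e1 : ∀ n, ∫ ω, X n ω ∂P = c := fun n => by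
    rw [integral_eq_lintegral_of_nonneg_ae (ae_of_all _ (hX0 n)) (hX n).aestronglyMeasurable,
      hmean, ENNReal.toReal_ofReal hc]
  have l2 : ∀ i m, ∫⁻ ω, ENNReal.ofReal (X i ω * X (i + m) ω) ∂P ≤
      ENNReal.ofReal (c ^ 2 + K * q ^ m) := fun i m => by
    simpa only [ENNReal.ofReal_mul (hX0 _ _)] using hcov i m
  have i2' : ∀ i m, Integrable (fun ω => X i ω * X (i + m) ω) P := fun i m =>
    (lintegral_ofReal_ne_top_iff_integrable ((hX i).mul (hX _)).aestronglyMeasurable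
      (ae_of_all _ fun ω => mul_nonneg (hX0 _ _) (hX0 _ _))).1
      (ne_top_of_le_ne_top ENNReal.ofReal_ne_top (l2 i m))
  have i2 : ∀ i j, Integrable (fun ω => X i ω * X j ω) P := fun i j => by
    rcases le_total i j with h | h
    · obtain ⟨m, rfl⟩ := Nat.exists_eq_add_of_le h
      exact i2' i m
    · obtain ⟨m, rfl⟩ := Nat.exists_eq_add_of_le h
      simpa only [mul_comm] using i2' j m
  have e2 : ∀ i m, ∫ ω, X i ω * X (i + m) ω ∂P ≤ c ^ 2 + K * q ^ m := fun i m => by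
    rw [integral_eq_lintegral_of_nonneg_ae
      (ae_of_all _ fun ω => mul_nonneg (hX0 _ _) (hX0 _ _))
      ((hX i).mul (hX _)).aestronglyMeasurable]
    exact ENNReal.toReal_le_of_le_ofReal (by positivity) (l2 i m)
  set Z : ℕ → Ω → ℝ := fun n ω => X n ω - c with hZ
  have iZ : ∀ i j, Integrable (fun ω => Z i ω * Z j ω) P := fun i j => by
    have : (fun ω => Z i ω * Z j ω) =
        fun ω => X i ω * X j ω - c * X i ω - c * X j ω + c ^ 2 := by
      funext ω; simp only [hZ]; ring
    rw [this]
    exact (((i2 i j).sub ((i1 i).const_mul c)).sub ((i1 j).const_mul c)).add (integrable_const _)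
  have eZ : ∀ i m, ∫ ω, Z i ω * Z (i + m) ω ∂P ≤ K * q ^ m := fun i m => by
    have : (fun ω => Z i ω * Z (i + m) ω) =
        fun ω => X i ω * X (i + m) ω - c * X i ω - c * X (i + m) ω + c ^ 2 := by
      funext ω; simp only [hZ]; ring
    have a1 : Integrable (fun ω => X i ω * X (i + m) ω - c * X i ω) P :=
      (i2 _ _).sub ((i1 _).const_mul c)
    have a2 : Integrable (fun ω => X i ω * X (i + m) ω - c * X i ω - c * X (i + m) ω) P :=
      a1.sub ((i1 _).const_mul c)
    rw [this, integral_add a2 (integrable_const _), integral_sub a1 ((i1 _).const_mul c),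
      integral_sub (i2 _ _) ((i1 _).const_mul c), integral_const_mul, integral_const_mul, e1, e1]
    simp
    linarith [e2 i m]
  set W : ℕ → Ω → ℝ := fun n ω => ∑ i ∈ Finset.range n, Z i ω with hW
  have hexp : ∀ n ω, W (n + 1) ω ^ 2 =
      W n ω ^ 2 + 2 * ∑ i ∈ Finset.range n, Z i ω * Z n ω + Z n ω * Z n ω := fun n ω => by
    simp only [hW]
    rw [Finset.sum_range_succ, ← Finset.sum_mul]
    ring
  have iS : ∀ n, Integrable (fun ω => ∑ i ∈ Finset.range n, Z i ω * Z n ω) P := fun n =>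
    integrable_finsetSum _ fun i _ => iZ i n
  have iW : ∀ n, Integrable (fun ω => W n ω ^ 2) P := fun n => by
    induction n with
    | zero => simp [hW]
    | succ n ih =>
      simp_rw [hexp]
      exact (ih.add ((iS n).const_mul 2)).add (iZ n n)
  -- Passing from `W n ^ 2` to `W (n + 1) ^ 2` adds in the mean at most twice the geometric series
  -- `∑ K q ^ i`, so the variance grows at most linearly with this slope.
  set C := 2 * K / (1 - q) with hC
  have hC0 : 0 ≤ C := div_nonneg (by positivity) (by linarith)
  have eW : ∀ n : ℕ, ∫ ω, W n ω ^ 2 ∂P ≤ C * n := fun n => by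
    induction n with
    | zero => simp [hW]
    | succ n ih =>
      simp_rw [hexp]
      have a1 : Integrable (fun ω => W n ω ^ 2 + 2 * ∑ i ∈ Finset.range n, Z i ω * Z n ω) P :=
        (iW n).add ((iS n).const_mul 2)
      rw [integral_add a1 (iZ n n), integral_add (iW n) ((iS n).const_mul 2), integral_const_mul,
        integral_finsetSum _ fun i _ => iZ i n]
      have b1 : ∑ i ∈ Finset.range n, ∫ ω, Z i ω * Z n ω ∂P ≤
          ∑ i ∈ Finset.range n, K * q ^ (n - i) := Finset.sum_le_sum fun i hi => by
        have := eZ i (n - i)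
        rwa [Nat.add_sub_cancel' (Finset.mem_range.1 hi).le] at this
      have b2 : ∫ ω, Z n ω * Z n ω ∂P ≤ K * q ^ 0 := eZ n 0
      have b3 : ∑ i ∈ Finset.range n, K * q ^ (n - i) + K * q ^ 0 ≤ K / (1 - q) := by
        have : ∑ i ∈ Finset.range n, K * q ^ (n - i) + K * q ^ 0 =
            K * ∑ i ∈ Finset.range (n + 1), q ^ i := by
          rw [← Finset.sum_range_reflect (fun i => q ^ i) (n + 1), Finset.sum_range_succ, ← Finset.mul_sum, mul_add]
          simp
        rw [this, div_eq_mul_inv]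
        refine mul_le_mul_of_nonneg_left ?_ hK
        rw [← tsum_geometric_of_lt_one hq hq1]
        exact (summable_geometric_of_lt_one hq hq1).sum_le_tsum _ fun i _ => by positivity
      have b4 : 0 ≤ K * q ^ 0 := by positivity
      have : C = 2 * (K / (1 - q)) := by rw [hC]; ring
      push_cast
      rw [this] at ih ⊢
      linarith
  -- Along the squares the second moments of `W (N k) / N k` are at most `C / (k + 1) ^ 2`, hence
  -- summable. So the sum of the squared averages is almost surely finite, and its terms tend to
  -- `0`.
  set N : ℕ → ℕ := fun k => (k + 1) ^ 2 with hN
  have hNpos : ∀ k, (0 : ℝ) < N k := fun k => by simp only [hN]; positivity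
  have hlin : ∀ k, ∫⁻ ω, ENNReal.ofReal ((W (N k) ω / N k) ^ 2) ∂P ≤
      ENNReal.ofReal (C * (1 / ((k : ℝ) + 1) ^ 2)) := fun k => by
    have : (fun ω => (W (N k) ω / N k) ^ 2) = fun ω => (1 / (N k : ℝ) ^ 2) * W (N k) ω ^ 2 := by
      funext ω; ring
    rw [← ofReal_integral_eq_lintegral_ofReal]
    · refine ENNReal.ofReal_le_ofReal ?_
      rw [this, integral_const_mul]
      calc 1 / (N k : ℝ) ^ 2 * ∫ ω, W (N k) ω ^ 2 ∂P ≤ 1 / (N k : ℝ) ^ 2 * (C * N k) :=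
            mul_le_mul_of_nonneg_left (eW _) (by positivity)
        _ = C * (1 / ((k : ℝ) + 1) ^ 2) := by
            have := (hNpos k).ne'
            have h2 : (N k : ℝ) = ((k : ℝ) + 1) ^ 2 := by simp [hN]
            rw [← h2]
            field_simp
    · rw [this]
      exact (iW _).const_mul _
    · exact ae_of_all _ fun ω => sq_nonneg _
  have hsum : Summable fun k : ℕ => C * (1 / ((k : ℝ) + 1) ^ 2) := by
    refine Summable.mul_left C ?_
    have := (summable_nat_add_iff 1).2 (Real.summable_one_div_nat_pow.2 one_lt_two)
    simpa using this
  have hWm : ∀ n, Measurable (W n) := fun n =>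
    Finset.measurable_fun_sum _ fun i _ => (hX i).sub_const c
  have hfin : ∫⁻ ω, ∑' k, ENNReal.ofReal ((W (N k) ω / N k) ^ 2) ∂P ≠ ⊤ := by
    rw [lintegral_tsum fun k => (((hWm _).div_const _).pow_const 2).ennreal_ofReal.aemeasurable]
    refine ne_top_of_le_ne_top ?_ (ENNReal.tsum_le_tsum hlin)
    rw [← ENNReal.ofReal_tsum_of_nonneg (fun k => by positivity) hsum]
    exact ENNReal.ofReal_ne_top
  have hae := ae_lt_top (Measurable.tsum fun k =>
    (((hWm _).div_const _).pow_const 2).ennreal_ofReal) hfin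
  filter_upwards [hae] with ω hω
  refine tendsto_average_of_squares (fun n => hX0 n ω) ?_
  have t1 := ENNReal.tendsto_atTop_zero_of_tsum_ne_top hω.ne
  have t2 := (ENNReal.tendsto_toReal ENNReal.zero_ne_top).comp t1
  have t3 : Tendsto (fun k => (W (N k) ω / N k) ^ 2) atTop (𝓝 0) := by
    refine t2.congr fun k => ?_
    exact ENNReal.toReal_ofReal (sq_nonneg _)
  have t4 : Tendsto (fun k => |W (N k) ω / N k|) atTop (𝓝 0) := by
    have := (Real.continuous_sqrt.tendsto 0).comp t3
    rw [Real.sqrt_zero] at this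
    exact this.congr fun k => Real.sqrt_sq_eq_abs _
  have t5 := (tendsto_zero_iff_abs_tendsto_zero _).2 t4
  have t6 := t5.add_const c
  rw [zero_add] at t6
  refine t6.congr fun k => ?_
  have := (hNpos k).ne'
  simp only [hW, hZ, Finset.sum_sub_distrib, Finset.sum_const, Finset.card_range, nsmul_eq_mul]
  field_simp
  ring

end Averages

/-! ### Sojourn times: stationary mean of the excess, coupling, and ergodic averages. -/

section Sojourn

open scoped ENNReal

set_option linter.unusedSectionVars false

/-- Sojourn times in a queue: the first one is `v`, the gaps between arrivals are `A`, the service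
times of the later customers are `S`. -/
noncomputable def sojourn (v : ℝ) (A S : ℕ → ℝ) : ℕ → ℝ
  | 0 => v
  | n + 1 => max (sojourn v A S n - A n) 0 + S n

/-- The part of the sojourn time `v` that remains when the `d`-th next customer arrives. -/
noncomputable def excess (d : ℕ) (v : ℝ) (A : ℕ → ℝ) : ℝ :=
  max (v - ∑ i ∈ Finset.range d, A i) 0

lemma excess_nonneg (d : ℕ) (v : ℝ) (A : ℕ → ℝ) : 0 ≤ excess d v A := le_max_right _ _

lemma excess_mono (d : ℕ) (A : ℕ → ℝ) {v w : ℝ} (h : v ≤ w) : excess d v A ≤ excess d w A := by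
  unfold excess
  gcongr

lemma excess_le_add (d : ℕ) (A : ℕ → ℝ) {v w : ℝ} (h : v ≤ w) :
    excess d w A ≤ excess d v A + (w - v) := by
  refine max_le ?_ ?_
  · have : v - ∑ i ∈ Finset.range d, A i ≤ excess d v A := le_max_left _ _
    linarith
  · linarith [excess_nonneg d v A]

lemma sojourn_add (v : ℝ) (A S : ℕ → ℝ) (m n : ℕ) :
    sojourn v A S (m + n) = sojourn (sojourn v A S m) (dropSeq m A) (dropSeq m S) n := by
  induction n with
  | zero => rfl
  | succ n ih =>
    rw [← add_assoc, sojourn, ih, sojourn, dropSeq, dropSeq, add_comm n m]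

lemma sojourn_mono (A S : ℕ → ℝ) {v w : ℝ} (h : v ≤ w) (n : ℕ) :
    sojourn v A S n ≤ sojourn w A S n := by
  induction n with
  | zero => exact h
  | succ n ih =>
    unfold sojourn
    gcongr

lemma sojourn_nonneg {A S : ℕ → ℝ} (hS : ∀ n, 0 ≤ S n) {v : ℝ} (hv : 0 ≤ v) (n : ℕ) :
    0 ≤ sojourn v A S n := by
  cases n with
  | zero => exact hv
  | succ n => exact add_nonneg (le_max_right _ _) (hS n)

/-- Once the queue started from `v` empties, so does the one started from `0`, and the two agree
ever after. Until then the larger path is never reflected and follows the random walk from `v`. -/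
lemma sojourn_coupling {A S : ℕ → ℝ} {v : ℝ} (hv : 0 ≤ v) (n : ℕ) :
    sojourn v A S n = sojourn 0 A S n ∨
      (sojourn v A S n ≤ v + ∑ i ∈ Finset.range n, (S i - A i) ∧
        sojourn v A S n - sojourn 0 A S n ≤ v) := by
  induction n with
  | zero => right; simp [sojourn]
  | succ n ih =>
    have hm := sojourn_mono A S hv n
    rcases ih with ih | ⟨h1, h2⟩
    · left
      simp only [sojourn, ih]
    · rcases le_or_gt (sojourn v A S n - A n) 0 with h | h
      · left
        simp only [sojourn, max_eq_right h, max_eq_right (show sojourn 0 A S n - A n ≤ 0 by linarith)]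
      · right
        simp only [sojourn, max_eq_left h.le, Finset.sum_range_succ]
        have := le_max_left (sojourn 0 A S n - A n) 0
        constructor <;> linarith

/-- Before coalescence the walk from `v` is nonnegative, so the exponential factors have product at
least `1`. They replace the indicator of that event by a product whose mean decays geometrically. -/
lemma sojourn_le_add_exp {A S : ℕ → ℝ} (hS : ∀ n, 0 ≤ S n) {v η : ℝ} (hv : 0 ≤ v) (hη : 0 ≤ η)
    (n : ℕ) : sojourn v A S n - sojourn 0 A S n ≤
      v * Real.exp (η * v) * Real.exp (η * ∑ i ∈ Finset.range n, (S i - A i)) := by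
  rcases sojourn_coupling (A := A) (S := S) hv n with h | ⟨h1, h2⟩
  · rw [h, sub_self]
    positivity
  · refine h2.trans ?_
    rw [mul_assoc, ← Real.exp_add, ← mul_add]
    have h0 := sojourn_nonneg (A := A) hS hv n
    exact le_mul_of_one_le_right hv (Real.one_le_exp (mul_nonneg hη (h0.trans h1)))

@[fun_prop]
lemma measurable_sojourn (n : ℕ) :
    Measurable fun p : QueueState => sojourn p.1 p.2.1 p.2.2 n := by
  induction n with
  | zero => exact measurable_fst
  | succ n ih =>
    unfold sojourn
    fun_prop

@[fun_prop]
lemma measurable_excess (d : ℕ) : Measurable fun p : ℝ × (ℕ → ℝ) => excess d p.1 p.2 := by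
  unfold excess
  fun_prop

/-- The state of the queue when customer `n` arrives. -/
noncomputable def queueState (n : ℕ) (p : QueueState) : QueueState :=
  (sojourn p.1 p.2.1 p.2.2 n, (dropSeq n p.2.1, dropSeq n p.2.2))

variable {a θ : ℝ} [ha : Fact (0 < a)] [hθ : Fact (0 < θ)] [hs : Fact (0 < a + θ)]

/-- The stationary law of the state of the queue. -/
noncomputable abbrev stationaryLaw (a θ : ℝ) : Measure QueueState :=
  (expMeasure θ).prod (twoStreams a (a + θ))

lemma measurePreserving_queueState (n : ℕ) :
    MeasurePreserving (queueState n) (stationaryLaw a θ) (stationaryLaw a θ) := by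
  induction n with
  | zero => exact MeasurePreserving.id _
  | succ n ih =>
    have h : MeasurePreserving (fun p => (queueStep () p).1) (stationaryLaw a θ)
        (stationaryLaw a θ) := by
      have h1 : MeasurePreserving (queueStep ()) (stationaryLaw a θ)
          ((stationaryLaw a θ).prod (expMeasure a)) :=
        ⟨measurable_queueStep.comp (measurable_prodMk_left (x := ())), map_queueStep ()⟩
      exact measurePreserving_fst.comp h1
    have e : queueState (n + 1) = (fun p => (queueStep () p).1) ∘ queueState n := by
      funext p
      simp only [queueState, queueStep, Function.comp, dropSeq_dropSeq, sojourn, add_comm 1 n,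
        dropSeq, zero_add]
    rw [e]
    exact h.comp ih

lemma measurePreserving_sojourn (n : ℕ) :
    MeasurePreserving (fun p : QueueState => sojourn p.1 p.2.1 p.2.2 n) (stationaryLaw a θ)
      (expMeasure θ) :=
  measurePreserving_fst.comp (measurePreserving_queueState n)

lemma ae_twoStreams_pos {a s : ℝ} [Fact (0 < a)] [Fact (0 < s)] :
    ∀ᵐ z ∂twoStreams a s, (∀ n, 0 < z.1 n) ∧ ∀ n, 0 < z.2 n :=
  (Measure.quasiMeasurePreserving_fst.ae (ae_expStream_pos a)).and
    (Measure.quasiMeasurePreserving_snd.ae (ae_expStream_pos s))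

lemma ae_stationaryLaw_pos :
    ∀ᵐ p ∂stationaryLaw a θ, 0 < p.1 ∧ (∀ n, 0 < p.2.1 n) ∧ ∀ n, 0 < p.2.2 n :=
  (Measure.quasiMeasurePreserving_fst.ae (ae_expMeasure_pos θ)).and
    (Measure.quasiMeasurePreserving_snd.ae ae_twoStreams_pos)

/-- After `n` steps, the future is independent of the current sojourn time and of what the past
gaps were. -/
lemma exists_map_eq_prod (n : ℕ) : ∃ κ : Measure (ℝ × ℝ), IsProbabilityMeasure κ ∧
    MeasurePreserving (fun p : QueueState =>
      ((p.1 - ∑ i ∈ Finset.range n, p.2.1 i, sojourn p.1 p.2.1 p.2.2 n),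
        (dropSeq n p.2.1, dropSeq n p.2.2)))
      (stationaryLaw a θ) (κ.prod (twoStreams a (a + θ))) := by
  induction n with
  | zero =>
    have hm : Measurable fun v : ℝ => (v, v) := by fun_prop
    refine ⟨(expMeasure θ).map fun v => (v, v), Measure.isProbabilityMeasure_map hm.aemeasurable, ?_⟩
    have : IsProbabilityMeasure ((expMeasure θ).map fun v => (v, v)) :=
      Measure.isProbabilityMeasure_map hm.aemeasurable
    have h : MeasurePreserving (fun v : ℝ => (v, v)) (expMeasure θ)
      ((expMeasure θ).map fun v => (v, v)) := ⟨hm, rfl⟩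
    simpa [sojourn, dropSeq, Prod.map] using! h.prod (MeasurePreserving.id (twoStreams a (a + θ)))
  | succ n ih =>
    obtain ⟨κ, hκ, h⟩ := ih
    have hst : Measurable fun p : (ℝ × ℝ) × (ℝ × ℝ) =>
        (p.1.1 - p.2.1, max (p.1.2 - p.2.1) 0 + p.2.2) := by fun_prop
    refine ⟨_, Measure.isProbabilityMeasure_map
      (μ := κ.prod ((expMeasure a).prod (expMeasure (a + θ)))) hst.aemeasurable, ?_⟩
    have h2 := (measurePreserving_twoStreams_step (a := a) (s := a + θ) κ hst).comp h
    convert h2 using 1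
    funext p
    simp only [Function.comp, dropSeq_dropSeq, sojourn, add_comm 1 n, dropSeq, zero_add,
      Finset.sum_range_succ, sub_sub]

/-- By lack of memory `E (v - t)⁺ = exp (-θ t) / θ`. Each of the `d` gaps subtracted contributes its
Laplace transform at `θ`, which is `a / (a + θ)`. -/
lemma lintegral_excess (d : ℕ) :
    ∫⁻ p, ENNReal.ofReal (excess d p.1 p.2.1) ∂stationaryLaw a θ =
      ENNReal.ofReal ((a / (a + θ)) ^ d / θ) := by
  have h1 : ∀ t : ℝ, 0 ≤ t → ∫⁻ v, ENNReal.ofReal (v - t) ∂expMeasure θ =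
      ENNReal.ofReal (Real.exp (-(θ * t))) * ENNReal.ofReal (1 / θ) := by
    intro t ht
    rw [← lintegral_ofReal_expMeasure hθ.out, ← lintegral_expMeasure_memoryless ht (by fun_prop)]
    refine lintegral_congr fun x => ?_
    by_cases hx : t ≤ x
    · rw [Set.indicator_of_mem (show x ∈ Set.Ici t from hx)]
    · rw [Set.indicator_of_notMem (by simpa using hx), ENNReal.ofReal_of_nonpos (by linarith)]
  have h2 : ∀ v A, ENNReal.ofReal (excess d v A) =
      ENNReal.ofReal (v - ∑ i ∈ Finset.range d, A i) := fun v A => by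
    rw [excess, ENNReal.ofReal_max]
    simp
  simp_rw [h2]
  rw [lintegral_prod_symm _ (by fun_prop)]
  have h3 : ∀ᵐ z ∂twoStreams a (a + θ),
      ∫⁻ v, ENNReal.ofReal (v - ∑ i ∈ Finset.range d, z.1 i) ∂expMeasure θ =
      (∏ i ∈ Finset.range d, ENNReal.ofReal (Real.exp (-(θ * z.1 i)))) * ENNReal.ofReal (1 / θ) := by
    filter_upwards [ae_twoStreams_pos (a := a) (s := a + θ)] with z hz
    rw [h1 _ (Finset.sum_nonneg fun i _ => (hz.1 i).le), ← ENNReal.ofReal_prod_of_nonneg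
      fun i _ => (Real.exp_pos _).le, ← Real.exp_sum, Finset.sum_neg_distrib, Finset.mul_sum]
  rw [lintegral_congr_ae h3, lintegral_mul_const _ (by fun_prop), lintegral_prod _ (by fun_prop)]
  simp only [lintegral_const, measure_univ, mul_one]
  rw [lintegral_infinitePi_prod_range (expMeasure a)
    (g := fun x => ENNReal.ofReal (Real.exp (-(θ * x)))) (by fun_prop),
    lintegral_exp_expMeasure ha.out hs.out, ← ENNReal.ofReal_pow (by have := ha.out; have := hs.out; positivity),
    ← ENNReal.ofReal_mul (by have := ha.out; have := hs.out; positivity)]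
  congr 1
  ring

/-- The part of the `n`-th sojourn time that remains after `d` further arrivals. -/
noncomputable def laterExcess (d n : ℕ) (v : ℝ) (z : (ℕ → ℝ) × (ℕ → ℝ)) : ℝ :=
  excess d (sojourn v z.1 z.2 n) (dropSeq n z.1)

@[fun_prop]
lemma measurable_laterExcess (d n : ℕ) :
    Measurable fun p : QueueState => laterExcess d n p.1 p.2 := by
  have h : Measurable fun p : QueueState => (sojourn p.1 p.2.1 p.2.2 n, dropSeq n p.2.1) := by
    fun_prop
  exact (measurable_excess d).comp h

lemma laterExcess_eq_comp (d n m : ℕ) (p : QueueState) :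
    laterExcess d (n + m) p.1 p.2 = laterExcess d m (queueState n p).1 (queueState n p).2 := by
  rw [laterExcess, sojourn_add, laterExcess, queueState, dropSeq_dropSeq, add_comm n m]

lemma lintegral_laterExcess (d n : ℕ) :
    ∫⁻ p, ENNReal.ofReal (laterExcess d n p.1 p.2) ∂stationaryLaw a θ =
      ENNReal.ofReal ((a / (a + θ)) ^ d / θ) := by
  have h := (measurePreserving_queueState (a := a) (θ := θ) n).lintegral_comp
    (f := fun p => ENNReal.ofReal (excess d p.1 p.2.1)) (by fun_prop)
  rw [lintegral_excess] at h
  exact h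

lemma laterExcess_le {d n : ℕ} {v : ℝ} {z : (ℕ → ℝ) × (ℕ → ℝ)} (h1 : ∀ n, 0 ≤ z.1 n)
    (h2 : ∀ n, 0 ≤ z.2 n) (hv : 0 ≤ v) : laterExcess d n v z ≤ sojourn v z.1 z.2 n := by
  refine max_le ?_ (sojourn_nonneg h2 hv n)
  have : 0 ≤ ∑ i ∈ Finset.range d, dropSeq n z.1 i := Finset.sum_nonneg fun i _ => h1 _
  linarith

lemma excess_le_sojourn {A S : ℕ → ℝ} (hS : ∀ n, 0 ≤ S n) {v : ℝ} (hv : 0 ≤ v)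
    (n : ℕ) : excess n v A ≤ sojourn v A S n := by
  have h : v - ∑ i ∈ Finset.range n, A i ≤ sojourn v A S n := by
    induction n with
    | zero => simp [sojourn]
    | succ n ih =>
      rw [Finset.sum_range_succ, sojourn]
      linarith [le_max_left (sojourn v A S n - A n) 0, hS n]
  exact max_le h (sojourn_nonneg hS hv n)

/-- A weighted second moment of the stationary sojourn time. -/
noncomputable def sojournMoment (θ η : ℝ) : ℝ≥0∞ :=
  ∫⁻ v, ENNReal.ofReal (v * (v * Real.exp (η * v))) ∂expMeasure θ

/-- Since `v ^ 2` is at most a multiple of `exp (η v)`, the integrand is dominated by `exp (2 η v)`,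
whence the condition `2 * η < θ`. -/
lemma sojournMoment_ne_top {η : ℝ} (hη : 0 < η) (h : 2 * η < θ) : sojournMoment θ η ≠ ⊤ := by
  have hle : ∀ᵐ v ∂expMeasure θ, ENNReal.ofReal (v * (v * Real.exp (η * v))) ≤
      ENNReal.ofReal (2 / η ^ 2) * ENNReal.ofReal (Real.exp (-(-(2 * η) * v))) := by
    filter_upwards [ae_expMeasure_pos θ] with v hv
    rw [← ENNReal.ofReal_mul (by positivity)]
    refine ENNReal.ofReal_le_ofReal ?_
    have h1 : (η * v) ^ 2 / 2 ≤ Real.exp (η * v) := by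
      have := Real.quadratic_le_exp_of_nonneg (x := η * v) (by positivity)
      have h2 : 0 ≤ η * v := by positivity
      linarith
    have h2 : -(-(2 * η) * v) = η * v + η * v := by ring
    rw [h2, Real.exp_add, ← mul_assoc, ← mul_assoc]
    refine mul_le_mul_of_nonneg_right ?_ (Real.exp_pos _).le
    calc v * v = 2 / η ^ 2 * ((η * v) ^ 2 / 2) := by field_simp
      _ ≤ _ := mul_le_mul_of_nonneg_left h1 (by positivity)
  refine ne_top_of_le_ne_top ?_ (lintegral_mono_ae hle)
  rw [lintegral_const_mul _ (by fun_prop), lintegral_exp_expMeasure hθ.out (by linarith)]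
  exact ENNReal.mul_ne_top ENNReal.ofReal_ne_top ENNReal.ofReal_ne_top

/-- The expectation of `exp (η (S - A))`. -/
noncomputable def driftFactor (a θ η : ℝ) : ℝ := a / (a + η) * ((a + θ) / (a + θ - η))

lemma lintegral_exp_drift {η : ℝ} (hη : 0 < η) (h : η < θ) (m : ℕ) :
    ∫⁻ z, ENNReal.ofReal (Real.exp (η * ∑ i ∈ Finset.range m, (z.2 i - z.1 i)))
      ∂twoStreams a (a + θ) = ENNReal.ofReal (driftFactor a θ η) ^ m := by
  have ha' := ha.out
  have e : ∀ z : (ℕ → ℝ) × (ℕ → ℝ),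
      ENNReal.ofReal (Real.exp (η * ∑ i ∈ Finset.range m, (z.2 i - z.1 i))) =
      (∏ i ∈ Finset.range m, ENNReal.ofReal (Real.exp (-(η * z.1 i)))) *
      ∏ i ∈ Finset.range m, ENNReal.ofReal (Real.exp (-(-η * z.2 i))) := fun z => by
    rw [← ENNReal.ofReal_prod_of_nonneg fun i _ => (Real.exp_pos _).le,
      ← ENNReal.ofReal_prod_of_nonneg fun i _ => (Real.exp_pos _).le,
      ← ENNReal.ofReal_mul (Finset.prod_nonneg fun i _ => (Real.exp_pos _).le),
      ← Real.exp_sum, ← Real.exp_sum, ← Real.exp_add, ← Finset.sum_add_distrib, Finset.mul_sum]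
    congr 3
    funext i
    ring
  simp_rw [e]
  rw [twoStreams, lintegral_prod_mul (f := fun A : ℕ → ℝ =>
      ∏ i ∈ Finset.range m, ENNReal.ofReal (Real.exp (-(η * A i))))
      (g := fun S : ℕ → ℝ => ∏ i ∈ Finset.range m, ENNReal.ofReal (Real.exp (-(-η * S i))))
      (Measurable.aemeasurable (by fun_prop)) (Measurable.aemeasurable (by fun_prop)),
    lintegral_infinitePi_prod_range (expMeasure a)
      (g := fun x => ENNReal.ofReal (Real.exp (-(η * x)))) (by fun_prop),
    lintegral_infinitePi_prod_range (expMeasure (a + θ))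
      (g := fun x => ENNReal.ofReal (Real.exp (-(-η * x)))) (by fun_prop),
    lintegral_exp_expMeasure ha' (by linarith), lintegral_exp_expMeasure hs.out (by linarith),
    ← mul_pow, ← ENNReal.ofReal_mul (by positivity), driftFactor, sub_eq_add_neg]

/-- The first excess is determined after `d` gaps. Replacing the queue from step `d` on by one
started at `0` makes the later excess independent of it, and the product of means is at most the
square. The coupling bound controls the error of this replacement. -/
lemma lintegral_excess_mul_laterExcess_le {η : ℝ} (hη : 0 < η) (h : η < θ) (d m : ℕ) :
    ∫⁻ p, ENNReal.ofReal (laterExcess d 0 p.1 p.2) * ENNReal.ofReal (laterExcess d (d + m) p.1 p.2)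
      ∂stationaryLaw a θ ≤
      ENNReal.ofReal ((a / (a + θ)) ^ d / θ) ^ 2 +
        sojournMoment θ η * ENNReal.ofReal (driftFactor a θ η) ^ m := by
  obtain ⟨κ, hκ, hmp⟩ := exists_map_eq_prod (a := a) (θ := θ) d
  set c := ENNReal.ofReal ((a / (a + θ)) ^ d / θ) with hc
  set Q := ENNReal.ofReal (driftFactor a θ η) ^ m with hQ
  set G := twoStreams a (a + θ) with hG
  set M := ∫⁻ z, ENNReal.ofReal (laterExcess d m 0 z) ∂G with hM
  have hme : ∀ v, Measurable fun z => laterExcess d m v z := fun v =>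
    (measurable_laterExcess d m).comp measurable_prodMk_left
  -- A start from `0` lies below a stationary start, so its mean is at most the stationary one.
  have hMc : M ≤ c := by
    have h1 : ∀ᵐ v ∂expMeasure θ, M ≤ ∫⁻ z, ENNReal.ofReal (laterExcess d m v z) ∂G := by
      filter_upwards [ae_expMeasure_pos θ] with v hv
      refine lintegral_mono fun z => ENNReal.ofReal_le_ofReal ?_
      exact excess_mono _ _ (sojourn_mono _ _ hv.le _)
    calc M = ∫⁻ _, M ∂expMeasure θ := by simp
      _ ≤ ∫⁻ v, ∫⁻ z, ENNReal.ofReal (laterExcess d m v z) ∂G ∂expMeasure θ := lintegral_mono_ae h1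
      _ = c := by
        rw [hc, ← lintegral_laterExcess d m, lintegral_prod _ (by fun_prop)]
  set Φ : (ℝ × ℝ) × ((ℕ → ℝ) × (ℕ → ℝ)) → ℝ≥0∞ := fun q =>
    ENNReal.ofReal (max q.1.1 0) * ENNReal.ofReal (laterExcess d m q.1.2 q.2) with hΦ
  have hΦm : Measurable Φ := by
    have : Measurable fun q : (ℝ × ℝ) × ((ℕ → ℝ) × (ℕ → ℝ)) => laterExcess d m q.1.2 q.2 :=
      (measurable_laterExcess d m).comp (by fun_prop :
        Measurable fun q : (ℝ × ℝ) × ((ℕ → ℝ) × (ℕ → ℝ)) => (q.1.2, q.2))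
    fun_prop
  have e1 : ∫⁻ p, ENNReal.ofReal (laterExcess d 0 p.1 p.2) *
      ENNReal.ofReal (laterExcess d (d + m) p.1 p.2) ∂stationaryLaw a θ =
      ∫⁻ q, Φ q ∂κ.prod G := by
    rw [← hmp.lintegral_comp hΦm]
    refine lintegral_congr fun p => ?_
    rw [laterExcess_eq_comp]
    rfl
  have hpos : ∀ᵐ q ∂κ.prod G, 0 ≤ q.1.2 ∧ ((∀ n, 0 ≤ q.2.1 n) ∧ ∀ n, 0 ≤ q.2.2 n) := by
    have h2 : ∀ᵐ q ∂κ.prod G, 0 ≤ q.1.2 := by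
      have hset : MeasurableSet {q : (ℝ × ℝ) × ((ℕ → ℝ) × (ℕ → ℝ)) | 0 ≤ q.1.2} :=
        measurableSet_le measurable_const (by fun_prop)
      rw [← hmp.map_eq, ae_map_iff hmp.measurable.aemeasurable hset]
      filter_upwards [ae_stationaryLaw_pos (a := a) (θ := θ)] with p hp
      exact sojourn_nonneg (fun n => (hp.2.2 n).le) hp.1.le d
    have h3 : ∀ᵐ q ∂κ.prod G, (∀ n, 0 < q.2.1 n) ∧ ∀ n, 0 < q.2.2 n :=
      Measure.quasiMeasurePreserving_snd.ae ae_twoStreams_pos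
    filter_upwards [h2, h3] with q hq hq'
    exact ⟨hq, fun n => (hq'.1 n).le, fun n => (hq'.2 n).le⟩
  have hle : ∀ᵐ q ∂κ.prod G, Φ q ≤
      ENNReal.ofReal (max q.1.1 0) * ENNReal.ofReal (laterExcess d m 0 q.2) +
      (ENNReal.ofReal (max q.1.1 0) * ENNReal.ofReal (q.1.2 * Real.exp (η * q.1.2))) *
        ENNReal.ofReal (Real.exp (η * ∑ i ∈ Finset.range m, (q.2.2 i - q.2.1 i))) := by
    filter_upwards [hpos] with q hq
    rw [mul_assoc, ← mul_add, ← ENNReal.ofReal_mul (mul_nonneg hq.1 (Real.exp_pos _).le),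
      ← ENNReal.ofReal_add (show 0 ≤ laterExcess d m 0 q.2 from excess_nonneg _ _ _) (mul_nonneg (mul_nonneg hq.1 (Real.exp_pos _).le)
        (Real.exp_pos _).le)]
    refine mul_le_mul_right (ENNReal.ofReal_le_ofReal ?_) _
    have := excess_le_add d (dropSeq m q.2.1) (sojourn_mono q.2.1 q.2.2 hq.1 m)
    exact this.trans (add_le_add le_rfl (sojourn_le_add_exp hq.2.2 hq.1 hη.le m))
  have hw : ∫⁻ x, ENNReal.ofReal (max x.1 0) ∂κ = c := by
    have : ∫⁻ q, ENNReal.ofReal (max q.1.1 0) ∂κ.prod G = c := by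
      rw [hc, ← lintegral_excess d, ← hmp.lintegral_comp (by fun_prop)]
      rfl
    rw [← this, lintegral_prod _ (by fun_prop)]
    simp
  -- The remaining part of the first sojourn time is at most the sojourn time at step `d`, whose law
  -- is stationary; so one moment bounds the mixed weight.
  have hw2 : ∫⁻ x, ENNReal.ofReal (max x.1 0) * ENNReal.ofReal (x.2 * Real.exp (η * x.2)) ∂κ ≤
      sojournMoment θ η := by
    have e2 : ∫⁻ q, ENNReal.ofReal (max q.1.1 0) * ENNReal.ofReal (q.1.2 * Real.exp (η * q.1.2))
        ∂κ.prod G =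
        ∫⁻ x, ENNReal.ofReal (max x.1 0) * ENNReal.ofReal (x.2 * Real.exp (η * x.2)) ∂κ := by
      rw [lintegral_prod _ (by fun_prop)]
      simp
    rw [← e2, ← hmp.lintegral_comp (by fun_prop), sojournMoment,
      ← (measurePreserving_sojourn (a := a) (θ := θ) d).lintegral_comp (by fun_prop)]
    refine lintegral_mono_ae ?_
    filter_upwards [ae_stationaryLaw_pos (a := a) (θ := θ)] with p hp
    have h0 := sojourn_nonneg (A := p.2.1) (fun n => (hp.2.2 n).le) hp.1.le d
    rw [ENNReal.ofReal_mul (p := sojourn p.1 p.2.1 p.2.2 d) (q := _ * _) h0]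
    refine mul_le_mul_left (ENNReal.ofReal_le_ofReal ?_) _
    exact excess_le_sojourn (fun n => (hp.2.2 n).le) hp.1.le d
  rw [e1]
  refine (lintegral_mono_ae hle).trans ?_
  rw [lintegral_add_left]
  · rw [lintegral_prod_mul (f := fun x : ℝ × ℝ => ENNReal.ofReal (max x.1 0))
      (g := fun z => ENNReal.ofReal (laterExcess d m 0 z)) (by fun_prop)
      (hme 0).ennreal_ofReal.aemeasurable,
      lintegral_prod_mul (f := fun x : ℝ × ℝ =>
        ENNReal.ofReal (max x.1 0) * ENNReal.ofReal (x.2 * Real.exp (η * x.2)))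
      (g := fun z : (ℕ → ℝ) × (ℕ → ℝ) =>
        ENNReal.ofReal (Real.exp (η * ∑ i ∈ Finset.range m, (z.2 i - z.1 i))))
      (by fun_prop) (by fun_prop), hw, lintegral_exp_drift hη h, sq]
    gcongr
  · have h4 : Measurable fun q : (ℝ × ℝ) × ((ℕ → ℝ) × (ℕ → ℝ)) => laterExcess d m 0 q.2 :=
      (hme 0).comp measurable_snd
    fun_prop

/-- A crude bound for lags `m < d`, where the two excesses share gaps and no independence is
available. -/
lemma lintegral_laterExcess_mul_le_moment {η : ℝ} (hη : 0 < η) (d m : ℕ) :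
    ∫⁻ p, ENNReal.ofReal (laterExcess d 0 p.1 p.2) * ENNReal.ofReal (laterExcess d m p.1 p.2)
      ∂stationaryLaw a θ ≤ 2 * sojournMoment θ η := by
  have hle : ∀ᵐ p ∂stationaryLaw a θ,
      ENNReal.ofReal (laterExcess d 0 p.1 p.2) * ENNReal.ofReal (laterExcess d m p.1 p.2) ≤
      ENNReal.ofReal (sojourn p.1 p.2.1 p.2.2 0 *
        (sojourn p.1 p.2.1 p.2.2 0 * Real.exp (η * sojourn p.1 p.2.1 p.2.2 0))) +
      ENNReal.ofReal (sojourn p.1 p.2.1 p.2.2 m *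
        (sojourn p.1 p.2.1 p.2.2 m * Real.exp (η * sojourn p.1 p.2.1 p.2.2 m))) := by
    filter_upwards [ae_stationaryLaw_pos (a := a) (θ := θ)] with p hp
    have h1 : ∀ n, 0 ≤ p.2.1 n := fun n => (hp.2.1 n).le
    have h2 : ∀ n, 0 ≤ p.2.2 n := fun n => (hp.2.2 n).le
    have x0 := sojourn_nonneg (A := p.2.1) h2 hp.1.le 0
    have y0 := sojourn_nonneg (A := p.2.1) h2 hp.1.le m
    have hx := laterExcess_le (d := d) (n := 0) (z := p.2) h1 h2 hp.1.le
    have hy := laterExcess_le (d := d) (n := m) (z := p.2) h1 h2 hp.1.le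
    have hx0 : 0 ≤ laterExcess d 0 p.1 p.2 := excess_nonneg _ _ _
    have hy0 : 0 ≤ laterExcess d m p.1 p.2 := excess_nonneg _ _ _
    set x := sojourn p.1 p.2.1 p.2.2 0
    set y := sojourn p.1 p.2.1 p.2.2 m
    rw [← ENNReal.ofReal_mul hx0, ← ENNReal.ofReal_add (by positivity) (by positivity)]
    refine ENNReal.ofReal_le_ofReal ?_
    have k1 : x ≤ x * Real.exp (η * x) := le_mul_of_one_le_right x0 (Real.one_le_exp (by positivity))
    have k2 : y ≤ y * Real.exp (η * y) := le_mul_of_one_le_right y0 (Real.one_le_exp (by positivity))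
    calc _ ≤ x * y := mul_le_mul hx hy hy0 x0
      _ ≤ x * x + y * y := by nlinarith [sq_nonneg (x - y)]
      _ ≤ _ := add_le_add (mul_le_mul_of_nonneg_left k1 x0) (mul_le_mul_of_nonneg_left k2 y0)
  refine (lintegral_mono_ae hle).trans (le_of_eq ?_)
  rw [lintegral_add_left (by fun_prop),
    (measurePreserving_sojourn (a := a) (θ := θ) 0).lintegral_comp
      (f := fun v => ENNReal.ofReal (v * (v * Real.exp (η * v)))) (by fun_prop),
    (measurePreserving_sojourn (a := a) (θ := θ) m).lintegral_comp
      (f := fun v => ENNReal.ofReal (v * (v * Real.exp (η * v)))) (by fun_prop), ← sojournMoment,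
    two_mul]

lemma driftFactor_mem {η : ℝ} (hη : 0 < η) (h : η < θ) :
    0 < driftFactor a θ η ∧ driftFactor a θ η < 1 := by
  have := ha.out
  have h1 : 0 < a + θ - η := by linarith
  have h2 : 0 < a + θ := by linarith
  refine ⟨by unfold driftFactor; positivity, ?_⟩
  rw [driftFactor, div_mul_div_comm, div_lt_one (by positivity)]
  -- The denominator exceeds the numerator by `η * (θ - η)`.
  nlinarith

lemma ae_stationaryLaw_tendsto (d : ℕ) :
    ∀ᵐ p ∂stationaryLaw a θ, Tendsto (fun n : ℕ =>
      (∑ i ∈ Finset.range n, laterExcess d i p.1 p.2) / (n : ℝ)) atTop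
      (𝓝 ((a / (a + θ)) ^ d / θ)) := by
  have ha' := ha.out
  have hθ' := hθ.out
  -- Any `η` with `0 < 2 * η < θ` would do: the moment is finite and the drift factor is below `1`.
  set η := θ / 4 with hη'
  have hη : 0 < η := by positivity
  obtain ⟨q0, q1⟩ := driftFactor_mem (a := a) (θ := θ) hη (by linarith)
  set q := driftFactor a θ η
  set K := (sojournMoment θ η).toReal with hK
  have hKe : sojournMoment θ η = ENNReal.ofReal K :=
    (ENNReal.ofReal_toReal (sojournMoment_ne_top hη (by linarith))).symm
  have hK0 : 0 ≤ K := ENNReal.toReal_nonneg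
  -- Dividing by `q ^ d` absorbs both the shift of the decay by `d` lags and the crude bound for
  -- lags below `d`.
  refine ae_tendsto_average_of_covariance (X := fun i (p : QueueState) => laterExcess d i p.1 p.2)
    (K := 2 * K / q ^ d) (q := q) (fun n => measurable_laterExcess d n)
    (fun n p => excess_nonneg _ _ _) (by positivity) (by positivity) q0.le q1
    (lintegral_laterExcess d) fun i m => ?_
  have e : ∫⁻ p, ENNReal.ofReal (laterExcess d i p.1 p.2) *
      ENNReal.ofReal (laterExcess d (i + m) p.1 p.2) ∂stationaryLaw a θ =
      ∫⁻ p, ENNReal.ofReal (laterExcess d 0 p.1 p.2) * ENNReal.ofReal (laterExcess d m p.1 p.2)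
      ∂stationaryLaw a θ := by
    have h := (measurePreserving_queueState (a := a) (θ := θ) i).lintegral_comp
      (f := fun p => ENNReal.ofReal (laterExcess d 0 p.1 p.2) *
        ENNReal.ofReal (laterExcess d m p.1 p.2)) (by fun_prop)
    simpa only [← laterExcess_eq_comp, add_zero] using h
  rw [e]
  rcases lt_or_ge m d with hm | hm
  · refine (lintegral_laterExcess_mul_le_moment hη d m).trans ?_
    rw [hKe, show (2 : ℝ≥0∞) = ENNReal.ofReal 2 by simp, ← ENNReal.ofReal_mul (by norm_num)]
    refine ENNReal.ofReal_le_ofReal ?_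
    have h1 : 1 ≤ q ^ m / q ^ d := by
      rw [one_le_div (by positivity)]
      exact pow_le_pow_of_le_one q0.le q1.le hm.le
    calc 2 * K ≤ 2 * K * (q ^ m / q ^ d) := le_mul_of_one_le_right (by positivity) h1
      _ = 2 * K / q ^ d * q ^ m := by ring
      _ ≤ _ := le_add_of_nonneg_left (sq_nonneg _)
  · obtain ⟨k, rfl⟩ := Nat.exists_eq_add_of_le hm
    refine (lintegral_excess_mul_laterExcess_le hη (by linarith) d k).trans ?_
    rw [hKe, ← ENNReal.ofReal_pow q0.le, ← ENNReal.ofReal_mul hK0,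
      ← ENNReal.ofReal_pow (by positivity), ← ENNReal.ofReal_add (by positivity) (by positivity)]
    refine ENNReal.ofReal_le_ofReal (add_le_add le_rfl ?_)
    rw [pow_add, div_mul_eq_mul_div, le_div_iff₀ (by positivity)]
    have : 0 ≤ K * (q ^ d * q ^ k) := by positivity
    linarith

/-- For almost all gaps and service times, whatever the first sojourn time, the averages of the
sojourn times, each reduced by the following `d` gaps, converge. -/
lemma ae_twoStreams_tendsto (d : ℕ) :
    ∀ᵐ z ∂twoStreams a (a + θ), ∀ v : ℝ, 0 < v → Tendsto (fun n : ℕ =>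
      (∑ i ∈ Finset.range n, laterExcess d i v z) / (n : ℝ)) atTop
      (𝓝 ((a / (a + θ)) ^ d / θ)) := by
  have hae := Measure.ae_ae_of_ae_prod (ae_stationaryLaw_tendsto (a := a) (θ := θ) d)
  set c := (a / (a + θ)) ^ d / θ
  set good : ℝ → Prop := fun v => ∀ᵐ z ∂twoStreams a (a + θ), Tendsto (fun n : ℕ =>
      (∑ i ∈ Finset.range n, laterExcess d i v z) / (n : ℝ)) atTop (𝓝 c) with hgood
  -- Fubini gives convergence for almost every `v` only. Good values exist below every `1 / (k + 1)`
  -- and above every `k`; countably many of them sandwich all `v > 0` by monotonicity, outside one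
  -- null set.
  have low : ∀ k : ℕ, ∃ v, v < 1 / ((k : ℝ) + 1) ∧ good v := fun k => by
    have hk : (0 : ℝ) < 1 / ((k : ℝ) + 1) := by positivity
    by_contra hcon
    push Not at hcon
    have h1 : ∀ᵐ v ∂expMeasure θ, v ∈ Set.Ici (1 / ((k : ℝ) + 1)) := by
      filter_upwards [hae] with v hv
      by_contra h2
      exact hcon v (by simpa using h2) hv
    have h2 := (prob_compl_eq_zero_iff (μ := expMeasure θ) measurableSet_Ici).1 (mem_ae_iff.1 h1)
    rw [expMeasure_Ici hθ.out hk.le, ENNReal.ofReal_eq_one, Real.exp_eq_one_iff] at h2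
    nlinarith [hθ.out]
  have high : ∀ k : ℕ, ∃ v, (k : ℝ) ≤ v ∧ good v := fun k => by
    by_contra hcon
    push Not at hcon
    have h1 : ∀ᵐ v ∂expMeasure θ, v ∉ Set.Ici (k : ℝ) := by
      filter_upwards [hae] with v hv h2
      exact hcon v h2 hv
    have h2 := measure_eq_zero_iff_ae_notMem.2 h1
    rw [expMeasure_Ici hθ.out (by positivity)] at h2
    exact (ENNReal.ofReal_pos.2 (Real.exp_pos _)).ne' h2
  choose lo hlo hlog using low
  choose hi hhi hhig using high
  filter_upwards [ae_all_iff.2 hlog, ae_all_iff.2 hhig] with z h1 h2 v hv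
  obtain ⟨k, hk⟩ := exists_nat_one_div_lt hv
  obtain ⟨j, hj⟩ := exists_nat_ge v
  refine tendsto_of_tendsto_of_tendsto_of_le_of_le (h1 k) (h2 j) (fun n => ?_) fun n => ?_
  · refine div_le_div_of_nonneg_right (Finset.sum_le_sum fun i _ => ?_) (Nat.cast_nonneg n)
    exact excess_mono _ _ (sojourn_mono _ _ ((hlo k).trans hk).le _)
  · refine div_le_div_of_nonneg_right (Finset.sum_le_sum fun i _ => ?_) (Nat.cast_nonneg n)
    exact excess_mono _ _ (sojourn_mono _ _ (hj.trans (hhi j)) _)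

end Sojourn

/-! ### Joint law of the preparation gaps and the dispatch overshoots. -/

section Law

/-- The initial data of the kitchen: the first order time, and the state of the kitchen's queue
when that order arrives. -/
abbrev KitchenData : Type := ℝ × QueueState

/-- The data of a sample point: those of the kitchen, and the gaps of the dispatch clock. -/
noncomputable def sampleData (μ lam : ℝ) (ω : Sample) : KitchenData × (ℕ → ℝ) :=
  ((ω (Source.order, 0), (ω (Source.kitchen, 0) / μ,
    (fun n => ω (Source.order, n + 1), fun n => ω (Source.kitchen, n + 1) / μ))),
    fun n => ω (Source.rider, n) / lam)

lemma measurePreserving_expStream_div {r : ℝ} (hr : 0 < r) :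
    MeasurePreserving (fun (z : ℕ → ℝ) n => z n / r) (expStream 1) (expStream r) := by
  refine ⟨by fun_prop, ?_⟩
  have h := Measure.infinitePi_map_pi (fun _ : ℕ => expMeasure 1) (f := fun _ x => x / r)
    fun _ => by fun_prop
  simpa only [expMeasure_map_div hr] using h

lemma measurePreserving_sources :
    MeasurePreserving (fun ω : Sample => ((fun n => ω (Source.order, n),
      fun n => ω (Source.kitchen, n)), fun n => ω (Source.rider, n))) sampleLaw
      (((expStream 1).prod (expStream 1)).prod (expStream 1)) := by
  have h1 : sampleLaw.map (MeasurableEquiv.curry Source ℕ ℝ) =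
      Measure.infinitePi fun _ : Source => expStream 1 :=
    Measure.infinitePi_map_curry (fun (_ : Source) (_ : ℕ) => expMeasure 1)
  have hm : ∀ i : Source, Measurable fun x : Source → ℕ → ℝ => x i := fun i => by fun_prop
  have hind : iIndepFun (fun (i : Source) (x : Source → ℕ → ℝ) => x i)
      (Measure.infinitePi fun _ : Source => expStream 1) :=
    iIndepFun_infinitePi (X := fun _ x => x) fun _ => measurable_id
  have hmap : ∀ i : Source, (Measure.infinitePi fun _ : Source => expStream 1).map (fun x => x i) =
      expStream 1 := fun i => Measure.infinitePi_map_eval (fun _ : Source => expStream 1) i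
  have h2 : (Measure.infinitePi fun _ : Source => expStream 1).map
      (fun x => ((x Source.order, x Source.kitchen), x Source.rider)) =
      ((expStream 1).prod (expStream 1)).prod (expStream 1) := by
    have i1 := hind.indepFun_prodMk hm Source.order Source.kitchen Source.rider (by simp) (by simp)
    have i2 := hind.indepFun (i := Source.order) (j := Source.kitchen) (by simp)
    have e1 := (indepFun_iff_map_prod_eq_prod_map_map
      (((hm _).prodMk (hm _)).aemeasurable) (hm _).aemeasurable).1 i1
    have e2 := (indepFun_iff_map_prod_eq_prod_map_map
      (hm _).aemeasurable (hm _).aemeasurable).1 i2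
    rw [e1, e2, hmap, hmap, hmap]
  refine ⟨by fun_prop, ?_⟩
  rw [← h2, ← h1, Measure.map_map (by fun_prop) (MeasurableEquiv.measurable _)]
  rfl

lemma measurePreserving_sampleData {μ lam : ℝ} [hμ : Fact (0 < μ)] [hl : Fact (0 < lam)] :
    MeasurePreserving (sampleData μ lam) sampleLaw
      (((expMeasure 1).prod ((expMeasure μ).prod (twoStreams 1 μ))).prod (expStream lam)) := by
  have : Fact ((0 : ℝ) < 1) := ⟨one_pos⟩
  have h1 := (((MeasurePreserving.id (expStream 1)).prod
    (measurePreserving_expStream_div hμ.out)).prod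
    (measurePreserving_expStream_div hl.out)).comp measurePreserving_sources
  have h2 := (measurePreserving_prodAssoc (expMeasure 1) (expMeasure μ) (twoStreams 1 μ)).comp
    (measurePreserving_twoStreams_split 1 μ)
  exact (h2.prod (MeasurePreserving.id (expStream lam))).comp h1

/-- The time at which order `n` is prepared. -/
noncomputable def preparationTime (x : KitchenData) (n : ℕ) : ℝ :=
  x.1 + x.2.1 + ∑ i ∈ Finset.range n, departureGaps x.2 i

/-- The earliest time at which rider `n` may be sent. -/
noncomputable def dispatchTarget (d : ℕ) (x : KitchenData) (n : ℕ) : ℝ :=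
  if n < d then 0 else preparationTime x (n - d)

lemma measurable_dispatchTarget (d : ℕ) : Measurable (dispatchTarget d) := by
  refine measurable_pi_lambda _ fun n => ?_
  have h : ∀ i, Measurable fun x : KitchenData => departureGaps x.2 i := fun i =>
    (measurable_pi_apply i).comp (measurable_departureGaps.comp measurable_snd)
  unfold dispatchTarget preparationTime
  split_ifs
  · exact measurable_const
  · fun_prop

/-- The gaps between preparations, and the times that the riders are sent after the earliest
possible moment. -/
noncomputable def dispatchGaps (d : ℕ) (q : KitchenData × (ℕ → ℝ)) : (ℕ → ℝ) × (ℕ → ℝ) :=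
  (departureGaps q.1.2, overshoots (dispatchTarget d q.1, 0) q.2)

/-- The targets depend on the kitchen alone. Given the kitchen, the overshoots have the same law for
all targets, so they are independent of the preparation gaps, which Burke's theorem makes a Poisson
stream. -/
lemma measurePreserving_dispatchGaps {θ lam : ℝ} [Fact (0 < θ)] [Fact (0 < 1 + θ)]
    [Fact (0 < lam)] (d : ℕ) :
    MeasurePreserving (dispatchGaps d)
      (((expMeasure 1).prod (stationaryLaw 1 θ)).prod (expStream lam)) (twoStreams 1 lam) := by
  have : Fact ((0 : ℝ) < 1) := ⟨one_pos⟩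
  have h1 : MeasurePreserving (fun x : KitchenData => departureGaps x.2)
      ((expMeasure 1).prod (stationaryLaw 1 θ)) (expStream 1) :=
    MeasurePreserving.comp ⟨measurable_departureGaps, map_departureGaps⟩ measurePreserving_snd
  refine h1.skew_product (g := fun x g => overshoots (dispatchTarget d x, 0) g) ?_
    (ae_of_all _ fun x => map_overshoots _)
  have hd := measurable_dispatchTarget d
  have h2 : Measurable fun q : KitchenData × (ℕ → ℝ) => ((dispatchTarget d q.1, (0 : ℝ)), q.2) := by
    fun_prop
  exact measurable_overshoots.comp h2

/-- Properties of the gaps that hold almost surely under the stationary law also hold almost surely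
for the system that starts empty. -/
lemma ae_sampleLaw_dispatchGaps {θ lam : ℝ} [hθ : Fact (0 < θ)] [Fact (0 < 1 + θ)]
    [Fact (0 < lam)] (d : ℕ) {p : (ℕ → ℝ) × (ℕ → ℝ) → Prop} (hp : ∀ᵐ z ∂twoStreams 1 lam, p z) :
    ∀ᵐ ω ∂sampleLaw, p (dispatchGaps d (sampleData (1 + θ) lam ω)) := by
  have h1 := (measurePreserving_dispatchGaps (θ := θ) (lam := lam) d).quasiMeasurePreserving.ae hp
  -- In the empty system the first order meets no queue, so its sojourn time is a service time of
  -- rate `1 + θ` instead of the stationary rate `θ`. All other factors coincide.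
  have hac : ((expMeasure 1).prod ((expMeasure (1 + θ)).prod (twoStreams 1 (1 + θ)))).prod
      (expStream lam) ≪ ((expMeasure 1).prod (stationaryLaw 1 θ)).prod (expStream lam) :=
    ((Measure.AbsolutelyContinuous.refl _).prod
      ((expMeasure_absolutelyContinuous_expMeasure hθ.out).prod
        (Measure.AbsolutelyContinuous.refl _))).prod (Measure.AbsolutelyContinuous.refl _)
  exact (measurePreserving_sampleData (μ := 1 + θ) (lam := lam)).quasiMeasurePreserving.ae
    (hac.ae_le h1)

end Law

/-! ### Pathwise identification of the model with two queues in tandem. -/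

section Paths

lemma queueState_queueStep (n : ℕ) (p : QueueState) :
    queueState n (queueStep () p).1 = queueState (n + 1) p := by
  have h : (queueStep () p).1 = queueState 1 p := by
    simp [queueStep, queueState, sojourn]
  rw [h, add_comm n 1]
  simp only [queueState, sojourn_add, dropSeq_dropSeq, add_comm n 1]

lemma departureGaps_apply (p : QueueState) (n : ℕ) :
    departureGaps p n = max (p.2.1 n - sojourn p.1 p.2.1 p.2.2 n) 0 + p.2.2 n := by
  have h : ∀ n p, departureGaps p n = (queueStep () (queueState n p)).2 := by
    intro n
    induction n with
    | zero => intro p; rfl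
    | succ n ih =>
      intro p
      rw [← queueState_queueStep, ← ih]
      rfl
  rw [h]
  simp [queueStep, queueState, dropSeq]

/-- The number of epochs that have passed when `n` targets have been met. -/
noncomputable def epochsUsed (ρ g : ℕ → ℝ) : ℕ → ℕ
  | 0 => 0
  | n + 1 => epochsUsed ρ g n +
      (firstPassage (max (ρ n - ∑ i ∈ Finset.range (epochsUsed ρ g n), g i) 0)
        (dropSeq (epochsUsed ρ g n) g) + 1)

lemma sum_range_dropSeq (g : ℕ → ℝ) (j k : ℕ) :
    ∑ i ∈ Finset.range (j + k), g i =
      ∑ i ∈ Finset.range j, g i + ∑ i ∈ Finset.range k, dropSeq j g i := by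
  rw [Finset.sum_range_add]
  simp [dropSeq, add_comm]

lemma dropSeq_one_consSeq (x : ℝ) (z : ℕ → ℝ) : dropSeq 1 (consSeq (x, z)) = z := rfl

lemma overshoots_apply (ρ g : ℕ → ℝ) (n : ℕ) :
    overshoots (ρ, 0) g n = ∑ i ∈ Finset.range (epochsUsed ρ g (n + 1)), g i -
      max (∑ i ∈ Finset.range (epochsUsed ρ g n), g i) (ρ n) := by
  set u : ℕ → ℝ := fun m => ∑ i ∈ Finset.range (epochsUsed ρ g m), g i with hu
  have hmax : ∀ m, max (u m) (ρ m) = u m + max (ρ m - u m) 0 := fun m => by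
    rcases le_total (u m) (ρ m) with h | h
    · rw [max_eq_right h, max_eq_left (by linarith)]; ring
    · rw [max_eq_left h, max_eq_right (by linarith)]; ring
  have hstep : ∀ m, overshootStep (dropSeq m ρ, u m) (dropSeq (epochsUsed ρ g m) g) =
      (dropSeq (epochsUsed ρ g (m + 1)) g, u (m + 1) - max (u m) (ρ m)) := fun m => by
    rw [hmax]
    simp only [overshootStep, restart, dropSeq_one_consSeq, dropSeq_dropSeq, Prod.mk.injEq]
    have e : dropSeq m ρ 0 = ρ m := by simp [dropSeq]
    rw [e]
    refine ⟨?_, ?_⟩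
    · rw [epochsUsed, add_comm]
    · simp only [hu, consSeq]
      rw [epochsUsed, sum_range_dropSeq g (epochsUsed ρ g m)]
      ring
  have key : ∀ n m, outputs overshootStep overshootUpdate (dropSeq m ρ, u m)
      (dropSeq (epochsUsed ρ g m) g) n = u (m + n + 1) - max (u (m + n)) (ρ (m + n)) := by
    intro n
    induction n with
    | zero =>
      intro m
      rw [outputs, hstep]
      rfl
    | succ n ih =>
      intro m
      rw [outputs, hstep]
      have : overshootUpdate (dropSeq m ρ, u m) (u (m + 1) - max (u m) (ρ m)) =
          (dropSeq (m + 1) ρ, u (m + 1)) := by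
        simp [overshootUpdate, dropSeq_dropSeq, dropSeq, add_comm]
      rw [this, ih]
      simp only [add_assoc, add_comm 1 n]
  have := key n 0
  simpa [hu, epochsUsed, dropSeq, overshoots] using! this

variable {μ lam : ℝ} {ω : Sample}

lemma readyTime_sub_orderTime (μ : ℝ) (ω : Sample) (n : ℕ) :
    readyTime μ ω n - orderTime ω n = sojourn (ω (Source.kitchen, 0) / μ)
      (fun n => ω (Source.order, n + 1)) (fun n => ω (Source.kitchen, n + 1) / μ) n := by
  induction n with
  | zero => simp [readyTime, sojourn]
  | succ n ih =>
    have e : orderTime ω (n + 1) = orderTime ω n + ω (Source.order, n + 1) := by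
      rw [orderTime, Finset.sum_range_succ]
      rfl
    rw [sojourn, ← ih, readyTime, e]
    rcases le_total (orderTime ω n + ω (Source.order, n + 1)) (readyTime μ ω n) with h | h
    · rw [max_eq_right h, max_eq_left (by linarith)]; ring
    · rw [max_eq_left h, max_eq_right (by linarith)]; ring

lemma readyTime_eq_preparationTime (μ lam : ℝ) (ω : Sample) (n : ℕ) :
    readyTime μ ω n = preparationTime (sampleData μ lam ω).1 n := by
  induction n with
  | zero => simp [readyTime, preparationTime, sampleData, orderTime]
  | succ n ih =>
    have h := readyTime_sub_orderTime μ ω n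
    have e : orderTime ω (n + 1) = orderTime ω n + ω (Source.order, n + 1) := by
      rw [orderTime, Finset.sum_range_succ]
      rfl
    rw [preparationTime, Finset.sum_range_succ, ← add_assoc, ← preparationTime, ← ih,
      departureGaps_apply]
    simp only [sampleData]
    rw [← h, readyTime, e]
    rcases le_total (orderTime ω n + ω (Source.order, n + 1)) (readyTime μ ω n) with h | h
    · rw [max_eq_right h, max_eq_right (by linarith)]; ring
    · rw [max_eq_left h, max_eq_left (by linarith)]; ring

/-- The sample points at which all durations are positive, and infinitely many orders and calls
come. -/
structure Regular (ω : Sample) : Prop where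
  pos : ∀ i, 0 < ω i
  order_tendsto : Tendsto (fun n => ∑ i ∈ Finset.range n, ω (Source.order, i)) atTop atTop
  rider_tendsto : Tendsto (fun n => ∑ i ∈ Finset.range n, ω (Source.rider, i)) atTop atTop

lemma ae_regular : ∀ᵐ ω ∂sampleLaw, Regular ω := by
  have : Fact ((0 : ℝ) < 1) := ⟨one_pos⟩
  have h := measurePreserving_sources.quasiMeasurePreserving
  have h1 : ∀ᵐ ω ∂sampleLaw, ∀ i, 0 < ω i := by
    have : Countable (Source × ℕ) := by
      have : Finite Source := Finite.of_surjective (fun i : Fin 3 =>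
        if i = 0 then Source.order else if i = 1 then Source.kitchen else Source.rider) (by
          rintro (_ | _ | _)
          exacts [⟨0, rfl⟩, ⟨1, rfl⟩, ⟨2, rfl⟩])
      infer_instance
    exact ae_all_iff.2 fun i =>
      (measurePreserving_eval_infinitePi (fun _ : Source × ℕ => expMeasure 1) i).quasiMeasurePreserving.ae
        (ae_expMeasure_pos 1)
  have h2 := h.ae (Measure.quasiMeasurePreserving_fst.ae (Measure.quasiMeasurePreserving_fst.ae
    (ae_expStream_tendsto_sum (r := 1))))
  have h3 := h.ae (Measure.quasiMeasurePreserving_snd.ae (ae_expStream_tendsto_sum (r := 1)))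
  filter_upwards [h1, h2, h3] with ω k1 k2 k3
  exact ⟨k1, k2, k3⟩

lemma Regular.strictMono_readyTime (h : Regular ω) (hμ : 0 < μ) : StrictMono (readyTime μ ω) :=
  strictMono_nat_of_lt_succ fun n => by
    rw [readyTime]
    have := div_pos (h.pos (Source.kitchen, n + 1)) hμ
    linarith [le_max_right (orderTime ω (n + 1)) (readyTime μ ω n)]

lemma Regular.orderTime_le_readyTime (h : Regular ω) (hμ : 0 < μ) (n : ℕ) :
    orderTime ω n ≤ readyTime μ ω n := by
  cases n with
  | zero =>
    rw [readyTime]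
    linarith [div_pos (h.pos (Source.kitchen, 0)) hμ]
  | succ n =>
    rw [readyTime]
    have := div_pos (h.pos (Source.kitchen, n + 1)) hμ
    linarith [le_max_left (orderTime ω (n + 1)) (readyTime μ ω n)]

lemma Regular.lt_readyCount_iff (h : Regular ω) (hμ : 0 < μ) (m : ℕ) (t : ℝ) :
    m < readyCount μ ω t ↔ readyTime μ ω m ≤ t := by
  have hex : ∃ n, t < readyTime μ ω n := by
    obtain ⟨n, hn⟩ := ((h.order_tendsto.comp (tendsto_add_atTop_nat 1)).eventually_gt_atTop t).exists
    exact ⟨n, lt_of_lt_of_le hn (h.orderTime_le_readyTime hμ n)⟩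
  classical
  have hset : {n : ℕ | readyTime μ ω n ≤ t} = Set.Iio (Nat.find hex) := by
    ext n
    simp only [Set.mem_ofPred_eq, Set.mem_Iio, Nat.lt_find_iff, not_lt]
    constructor
    · intro hn k hk
      exact ((h.strictMono_readyTime hμ).monotone hk).trans hn
    · intro hn
      exact hn n le_rfl
  have hcard : readyCount μ ω t = Nat.find hex := by
    rw [readyCount, hset]
    simp [Set.ncard_eq_toFinset_card']
  rw [hcard, ← Set.mem_Iio, ← hset]
  rfl

/-- With `n` riders sent, there is room for another exactly when order `n - d` is prepared. For `n <
d` there is always room, hence the target `0`. -/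
lemma Regular.send_iff (h : Regular ω) (hμ : 0 < μ) (hl : 0 < lam) (d n k : ℕ) :
    -(d : ℤ) < (readyCount μ ω (callTime lam ω k) : ℤ) - (n : ℤ) ↔
      dispatchTarget d (sampleData μ lam ω).1 n ≤ callTime lam ω k := by
  unfold dispatchTarget
  split_ifs with hn
  · have h0 : 0 ≤ callTime lam ω k := Finset.sum_nonneg fun i _ => (div_pos (h.pos _) hl).le
    simp only [h0, iff_true]
    omega
  · rw [← readyTime_eq_preparationTime, ← h.lt_readyCount_iff hμ]
    omega

lemma monotone_sentCount (μ lam : ℝ) (d : ℕ) (ω : Sample) : Monotone (sentCount μ lam d ω) :=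
  monotone_nat_of_le_succ fun k => by
    rw [sentCount]
    split_ifs <;> omega

/-- Together the two counts locate the dispatch of rider `n` at the last epoch used for target `n`:
the count is still `n` before that epoch and `n + 1` after it. -/
lemma Regular.sentCount_epochsUsed (h : Regular ω) (hμ : 0 < μ) (hl : 0 < lam) (d n : ℕ) :
    sentCount μ lam d ω (epochsUsed (dispatchTarget d (sampleData μ lam ω).1)
      (sampleData μ lam ω).2 n) = n ∧
    sentCount μ lam d ω (epochsUsed (dispatchTarget d (sampleData μ lam ω).1)
      (sampleData μ lam ω).2 (n + 1) - 1) = n := by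
  set ρ := dispatchTarget d (sampleData μ lam ω).1 with hρ
  set g := (sampleData μ lam ω).2 with hg
  set j := epochsUsed ρ g with hj
  have gpos : ∀ i, 0 ≤ g i := fun i => (div_pos (h.pos _) hl).le
  have gsum : Tendsto (fun n => ∑ i ∈ Finset.range n, g i) atTop atTop := by
    have : (fun n => ∑ i ∈ Finset.range n, g i) =
        fun n => (∑ i ∈ Finset.range n, ω (Source.rider, i)) / lam := by
      funext n
      rw [Finset.sum_div]
      rfl
    rw [this]
    exact h.rider_tendsto.atTop_div_const hl
  have hiff : ∀ n i, -(d : ℤ) < (readyCount μ ω (callTime lam ω (j n + i)) : ℤ) - (n : ℤ) ↔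
      max (ρ n - ∑ i ∈ Finset.range (j n), g i) 0 ≤
        ∑ l ∈ Finset.range (i + 1), dropSeq (j n) g l := fun n i => by
    have e : callTime lam ω (j n + i) = ∑ l ∈ Finset.range (j n), g l +
        ∑ l ∈ Finset.range (i + 1), dropSeq (j n) g l := by
      rw [← sum_range_dropSeq]
      rfl
    have h0 : 0 ≤ ∑ l ∈ Finset.range (i + 1), dropSeq (j n) g l :=
      Finset.sum_nonneg fun l _ => gpos _
    rw [h.send_iff hμ hl, ← hρ, e, max_le_iff]
    constructor
    · intro h1
      exact ⟨by linarith, h0⟩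
    · rintro ⟨h1, -⟩
      linarith
  have hsucc : ∀ n, j (n + 1) = j n + (firstPassage (max (ρ n - ∑ i ∈ Finset.range (j n), g i) 0)
      (dropSeq (j n) g) + 1) := fun n => rfl
  -- Epochs before the first passage over the target are dropped calls, so the count stays constant.
  have hrun : ∀ n, sentCount μ lam d ω (j n) = n → ∀ i,
      i ≤ firstPassage (max (ρ n - ∑ i ∈ Finset.range (j n), g i) 0) (dropSeq (j n) g) →
      sentCount μ lam d ω (j n + i) = n := fun n hn i => by
    induction i with
    | zero => intro _; exact hn
    | succ i ih =>
      intro hi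
      rw [← add_assoc, sentCount, ih (by omega), if_neg]
      rw [hiff, not_le]
      exact sum_lt_of_lt_firstPassage (by omega)
  have hmain : ∀ n, sentCount μ lam d ω (j n) = n := fun n => by
    induction n with
    | zero => rfl
    | succ n ih =>
      have h1 := hrun n ih _ le_rfl
      rw [hsucc, ← add_assoc, sentCount, h1, if_pos]
      rw [hiff]
      refine firstPassage_mem ?_
      obtain ⟨k, hk⟩ := ((gsum.comp (tendsto_add_atTop_nat (j n + 1))).eventually_ge_atTop
        (max (ρ n - ∑ i ∈ Finset.range (j n), g i) 0 + ∑ i ∈ Finset.range (j n), g i)).exists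
      refine ⟨k, ?_⟩
      simp only [Function.comp, show k + (j n + 1) = j n + (k + 1) by ring,
        sum_range_dropSeq g (j n)] at hk
      linarith
  refine ⟨hmain n, ?_⟩
  have := hrun n (hmain n) _ le_rfl
  rw [hsucc]
  exact this

lemma Regular.riderTime_eq (h : Regular ω) (hμ : 0 < μ) (hl : 0 < lam) (d n : ℕ) :
    riderTime μ lam d ω n = ∑ i ∈ Finset.range (epochsUsed
      (dispatchTarget d (sampleData μ lam ω).1) (sampleData μ lam ω).2 (n + 1)),
      (sampleData μ lam ω).2 i := by
  set j := epochsUsed (dispatchTarget d (sampleData μ lam ω).1) (sampleData μ lam ω).2 with hj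
  have hpos : 1 ≤ j (n + 1) := by
    rw [hj, epochsUsed]
    omega
  obtain ⟨k, hk⟩ := Nat.exists_eq_add_of_le' hpos
  have h1 := (h.sentCount_epochsUsed hμ hl d (n + 1)).1
  have h2 := (h.sentCount_epochsUsed hμ hl d n).2
  rw [← hj, hk] at h1 h2
  have hs : sInf {k : ℕ | n < sentCount μ lam d ω (k + 1)} = k := by
    refine nat_sInf_eq ?_ fun m hm hmem => ?_
    · rw [Set.mem_ofPred_eq, h1]
      exact Nat.lt_succ_self n
    · have := monotone_sentCount μ lam d ω (show m + 1 ≤ k + 1 - 1 by omega)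
      rw [h2] at this
      exact absurd hmem (not_lt.2 this)
  rw [riderTime, hs, hk]
  rfl

/-- The excess of the time at which rider `d + m` is sent over the time at which order `m` is
prepared follows the recursion of a queue. -/
lemma Regular.riderTime_sub_readyTime (h : Regular ω) (hμ : 0 < μ) (hl : 0 < lam) (d m : ℕ) :
    riderTime μ lam d ω (m + d) - readyTime μ ω m =
      sojourn (riderTime μ lam d ω d - readyTime μ ω 0)
        (dispatchGaps d (sampleData μ lam ω)).1
        (dropSeq (d + 1) (dispatchGaps d (sampleData μ lam ω)).2) m := by
  set ρ := dispatchTarget d (sampleData μ lam ω).1 with hρ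
  set g := (sampleData μ lam ω).2 with hg
  induction m with
  | zero => simp [sojourn]
  | succ m ih =>
    have hD : (dispatchGaps d (sampleData μ lam ω)).1 m =
        readyTime μ ω (m + 1) - readyTime μ ω m := by
      rw [readyTime_eq_preparationTime μ lam, readyTime_eq_preparationTime μ lam, preparationTime,
        preparationTime, Finset.sum_range_succ, dispatchGaps]
      ring
    -- Riders `0` to `d - 1` precede the queue and rider `d` fixes its initial sojourn time, so the
    -- service times start with overshoot `d + 1`.
    have hE : dropSeq (d + 1) (dispatchGaps d (sampleData μ lam ω)).2 m =
        riderTime μ lam d ω (m + 1 + d) -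
          max (riderTime μ lam d ω (m + d)) (readyTime μ ω (m + 1)) := by
      have e1 : dispatchTarget d (sampleData μ lam ω).1 (m + 1 + d) = readyTime μ ω (m + 1) := by
        rw [dispatchTarget, if_neg (by omega), Nat.add_sub_cancel,
          ← readyTime_eq_preparationTime μ lam]
      rw [h.riderTime_eq hμ hl, h.riderTime_eq hμ hl, ← e1,
        show m + d + 1 = m + 1 + d by omega, ← overshoots_apply]
      simp only [dispatchGaps, dropSeq]
      congr 1
      omega
    rw [sojourn, ← ih, hD, hE]
    rcases le_total (riderTime μ lam d ω (m + d)) (readyTime μ ω (m + 1)) with h1 | h1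
    · rw [max_eq_right h1, max_eq_right (by linarith)]; ring
    · rw [max_eq_left h1, max_eq_left (by linarith)]; ring

/-- The ergodic averages are known for positive initial sojourn times; this supplies the positivity.
-/
lemma Regular.lt_riderTime (h : Regular ω) (hμ : 0 < μ) (hl : 0 < lam) (d : ℕ)
    (hE : 0 < (dispatchGaps d (sampleData μ lam ω)).2 d) :
    0 < riderTime μ lam d ω d - readyTime μ ω 0 := by
  have e1 : dispatchTarget d (sampleData μ lam ω).1 d = readyTime μ ω 0 := by
    rw [dispatchTarget, if_neg (by omega), Nat.sub_self, ← readyTime_eq_preparationTime μ lam]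
  have e2 := overshoots_apply (dispatchTarget d (sampleData μ lam ω).1) (sampleData μ lam ω).2 d
  rw [← h.riderTime_eq hμ hl, e1] at e2
  have : 0 < overshoots (dispatchTarget d (sampleData μ lam ω).1, 0) (sampleData μ lam ω).2 d := hE
  linarith [le_max_right (∑ i ∈ Finset.range (epochsUsed (dispatchTarget d (sampleData μ lam ω).1)
    (sampleData μ lam ω).2 d), (sampleData μ lam ω).2 i) (readyTime μ ω 0)]

lemma readyTime_add (μ lam : ℝ) (ω : Sample) (d m : ℕ) : readyTime μ ω (m + d) =
    readyTime μ ω m +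
      ∑ i ∈ Finset.range d, dropSeq m (dispatchGaps d (sampleData μ lam ω)).1 i := by
  rw [readyTime_eq_preparationTime μ lam, readyTime_eq_preparationTime μ lam, preparationTime,
    preparationTime, sum_range_dropSeq, ← add_assoc]
  rfl

end Paths

/-! ### Long-run averages of the waiting times. -/

section Means

lemma tendsto_average_of_shift {u : ℕ → ℝ} {c : ℝ} (d : ℕ)
    (h : Tendsto (fun n : ℕ => (∑ k ∈ Finset.range n, u (k + d)) / (n : ℝ)) atTop (𝓝 c)) :
    Tendsto (fun n : ℕ => (∑ k ∈ Finset.range n, u k) / (n : ℝ)) atTop (𝓝 c) := by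
  rw [← tendsto_add_atTop_iff_nat d]
  set C := ∑ k ∈ Finset.range d, u k with hC
  have h1 : Tendsto (fun n : ℕ => (n : ℝ) / ((n : ℝ) + d)) atTop (𝓝 1) :=
    tendsto_natCast_div_add_atTop (d : ℝ)
  have h2 : Tendsto (fun n : ℕ => C / (((n + d : ℕ) : ℝ))) atTop (𝓝 0) :=
    (tendsto_const_div_atTop_nhds_zero_nat C).comp (tendsto_add_atTop_nat d)
  have h3 := (h.mul h1).add h2
  rw [mul_one, add_zero] at h3
  refine h3.congr' ?_
  filter_upwards [eventually_gt_atTop 0] with n hn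
  have e : ∑ k ∈ Finset.range (n + d), u k = C + ∑ k ∈ Finset.range n, u (k + d) := by
    rw [add_comm n d, Finset.sum_range_add]
    simp only [add_comm d, hC]
  have hn' : (0 : ℝ) < n := Nat.cast_pos.2 hn
  have hnd : (0 : ℝ) < (n : ℝ) + d := by positivity
  rw [e]
  push_cast
  field_simp
  ring

/-- An order's wait is the first summand plus the second, and a rider's wait is the second minus the
third. Thus two applications of the ergodic averages to the second queue, with `d` and `0` gaps
subtracted, and one to the kitchen give both means. -/
lemma ae_tendsto_means {μ lam : ℝ} (hμ : 1 < μ) (hl : 1 < lam) (d : ℕ) :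
    ∀ᵐ ω ∂sampleLaw,
      Tendsto (fun n : ℕ => (∑ k ∈ Finset.range n, (readyTime μ ω k - orderTime ω k)) / (n : ℝ))
        atTop (𝓝 (1 / (μ - 1))) ∧
      Tendsto (fun n : ℕ => (∑ k ∈ Finset.range n,
        max (riderTime μ lam d ω k - readyTime μ ω k) 0) / (n : ℝ))
        atTop (𝓝 ((1 / lam) ^ d / (lam - 1))) ∧
      Tendsto (fun n : ℕ => (∑ k ∈ Finset.range n,
        (riderTime μ lam d ω k - readyTime μ ω k)) / (n : ℝ))
        atTop (𝓝 (1 / (lam - 1) - d)) := by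
  obtain ⟨θ, rfl⟩ : ∃ θ, μ = 1 + θ := ⟨μ - 1, by ring⟩
  obtain ⟨η, rfl⟩ : ∃ η, lam = 1 + η := ⟨lam - 1, by ring⟩
  have : Fact ((0 : ℝ) < 1) := ⟨one_pos⟩
  have : Fact (0 < θ) := ⟨by linarith⟩
  have : Fact (0 < η) := ⟨by linarith⟩
  have hμ0 : Fact (0 < 1 + θ) := ⟨by linarith⟩
  have hl0 : Fact (0 < 1 + η) := ⟨by linarith⟩
  -- The quantifier over `v` stands inside the almost sure statement because the initial sojourn
  -- time `Y` inserted later is random and may depend on the streams.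
  have good : ∀ᵐ z ∂twoStreams 1 (1 + η), (∀ n, 0 < z.2 n) ∧
      (∀ i, Tendsto (fun n : ℕ => (∑ k ∈ Finset.range n, dropSeq i z.1 k) / (n : ℝ)) atTop
        (𝓝 (1 / 1))) ∧
      ∀ (v : ℝ) (j : ℕ), 0 < v → Tendsto (fun n : ℕ =>
        (∑ i ∈ Finset.range n, laterExcess j i v (z.1, dropSeq (d + 1) z.2)) / (n : ℝ)) atTop
        (𝓝 ((1 / (1 + η)) ^ j / η)) := by
    have g1 : ∀ᵐ z ∂twoStreams 1 (1 + η), ∀ i : ℕ, Tendsto (fun n : ℕ =>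
        (∑ k ∈ Finset.range n, dropSeq i z.1 k) / (n : ℝ)) atTop (𝓝 (1 / 1)) :=
      Measure.quasiMeasurePreserving_fst.ae (ae_all_iff.2 fun i =>
        (measurePreserving_dropSeq (expMeasure 1) i).quasiMeasurePreserving.ae
          ae_expStream_tendsto_average)
    have hmp := (MeasurePreserving.id (expStream 1)).prod
      (measurePreserving_dropSeq (expMeasure (1 + η)) (d + 1))
    have g2 := ae_all_iff.2 fun j =>
      hmp.quasiMeasurePreserving.ae (ae_twoStreams_tendsto (a := 1) (θ := η) j)
    filter_upwards [ae_twoStreams_pos (a := 1) (s := 1 + η), g1, g2] with z h1 h2 h3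
    exact ⟨h1.2, h2, fun v j hv => h3 j v hv⟩
  have kitchen : ∀ᵐ ω ∂sampleLaw, ∀ v : ℝ, 0 < v → Tendsto (fun n : ℕ =>
      (∑ i ∈ Finset.range n, laterExcess 0 i v (sampleData (1 + θ) (1 + η) ω).1.2.2) / (n : ℝ))
      atTop (𝓝 ((1 / (1 + θ)) ^ 0 / θ)) :=
    (measurePreserving_sampleData (μ := 1 + θ) (lam := 1 + η)).quasiMeasurePreserving.ae
      (Measure.quasiMeasurePreserving_fst.ae (Measure.quasiMeasurePreserving_snd.ae
        (Measure.quasiMeasurePreserving_snd.ae (ae_twoStreams_tendsto (a := 1) (θ := θ) 0))))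
  filter_upwards [ae_regular, ae_sampleLaw_dispatchGaps (θ := θ) d good, kitchen] with ω h1 h2 h3
  obtain ⟨k1, k2, k3⟩ := h2
  have hY := h1.lt_riderTime hμ0.out hl0.out d (k1 d)
  set z := dispatchGaps d (sampleData (1 + θ) (1 + η) ω) with hz
  set Y := riderTime (1 + θ) (1 + η) d ω d - readyTime (1 + θ) ω 0 with hYdef
  have hlater0 : ∀ (v : ℝ) (A S : ℕ → ℝ), 0 < v → (∀ n, 0 < S n) → ∀ i,
      laterExcess 0 i v (A, S) = sojourn v A S i := fun v A S hv hS i => by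
    simp only [laterExcess, excess, Finset.range_zero, Finset.sum_empty, sub_zero]
    exact max_eq_left (sojourn_nonneg (fun n => (hS n).le) hv.le i)
  have hdiff : ∀ m, riderTime (1 + θ) (1 + η) d ω (m + d) - readyTime (1 + θ) ω (m + d) =
      sojourn Y z.1 (dropSeq (d + 1) z.2) m - ∑ i ∈ Finset.range d, dropSeq m z.1 i := fun m => by
    rw [← h1.riderTime_sub_readyTime hμ0.out hl0.out, readyTime_add _ (1 + η)]
    ring
  refine ⟨?_, ?_, ?_⟩
  · have hv : 0 < ω (Source.kitchen, 0) / (1 + θ) := div_pos (h1.pos _) hμ0.out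
    have := h3 _ hv
    rw [pow_zero] at this
    simp only [add_sub_cancel_left]
    refine this.congr fun n => ?_
    congr 1
    refine Finset.sum_congr rfl fun i _ => ?_
    rw [readyTime_sub_orderTime]
    exact hlater0 _ _ _ hv (fun n => div_pos (h1.pos _) hμ0.out) i
  · refine tendsto_average_of_shift d ?_
    simp only [hdiff, add_sub_cancel_left]
    exact k3 Y d hY
  · refine tendsto_average_of_shift d ?_
    have t1 := k3 Y 0 hY
    -- Each of the `d` shifted gap sequences has average `1`, which produces the term `d`.
    have t2 := tendsto_finsetSum (Finset.range d) fun i _ => k2 i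
    have t3 := t1.sub t2
    simp only [pow_zero, Finset.sum_const, Finset.card_range, nsmul_eq_mul, div_one, mul_one] at t3
    simp only [hdiff, add_sub_cancel_left]
    refine t3.congr fun n => ?_
    rw [Finset.sum_sub_distrib, Finset.sum_comm, sub_div, ← Finset.sum_div]
    congr 2
    · exact Finset.sum_congr rfl fun i _ => hlater0 _ _ _ hY (fun n => k1 _) i
    · refine Finset.sum_congr rfl fun i _ => Finset.sum_congr rfl fun m _ => ?_
      simp only [dropSeq, add_comm]

lemma isMeanOrderWait {μ lam : ℝ} (hμ : 1 < μ) (hl : 1 < lam) (d : ℕ) :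
    IsMeanOrderWait μ lam d (1 / (μ - 1) + (1 / lam) ^ d / (lam - 1)) := by
  filter_upwards [ae_tendsto_means hμ hl d] with ω h
  refine (h.1.add h.2.1).congr fun n => ?_
  rw [← add_div, ← Finset.sum_add_distrib]
  congr 1
  refine Finset.sum_congr rfl fun k _ => ?_
  rw [orderWait, fetchTime]
  rcases le_total (readyTime μ ω k) (riderTime μ lam d ω k) with h1 | h1
  · rw [max_eq_right h1, max_eq_left (by linarith)]; ring
  · rw [max_eq_left h1, max_eq_right (by linarith)]; ring

lemma isMeanRiderWait {μ lam : ℝ} (hμ : 1 < μ) (hl : 1 < lam) (d : ℕ) :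
    IsMeanRiderWait μ lam d ((1 / lam) ^ d / (lam - 1) - (1 / (lam - 1) - d)) := by
  filter_upwards [ae_tendsto_means hμ hl d] with ω h
  refine (h.2.1.sub h.2.2).congr fun n => ?_
  rw [← sub_div, ← Finset.sum_sub_distrib]
  congr 1
  refine Finset.sum_congr rfl fun k _ => ?_
  rw [riderWait, fetchTime]
  rcases le_total (readyTime μ ω k) (riderTime μ lam d ω k) with h1 | h1
  · rw [max_eq_right h1, max_eq_left (by linarith)]; ring
  · rw [max_eq_left h1, max_eq_right (by linarith)]; ring

instance : IsProbabilityMeasure sampleLaw := by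
  unfold sampleLaw
  infer_instance

lemma meanOrderWait_eq {μ lam : ℝ} (hμ : 1 < μ) (hl : 1 < lam) (d : ℕ) :
    meanOrderWait μ lam d = 1 / (μ - 1) + (1 / lam) ^ d / (lam - 1) := by
  have h := isMeanOrderWait hμ hl d
  have h' : IsMeanOrderWait μ lam d (meanOrderWait μ lam d) := Classical.epsilon_spec ⟨_, h⟩
  obtain ⟨ω, h1, h2⟩ := (h.and h').exists
  exact tendsto_nhds_unique h2 h1

lemma meanRiderWait_eq {μ lam : ℝ} (hμ : 1 < μ) (hl : 1 < lam) (d : ℕ) :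
    meanRiderWait μ lam d = (1 / lam) ^ d / (lam - 1) - (1 / (lam - 1) - d) := by
  have h := isMeanRiderWait hμ hl d
  have h' : IsMeanRiderWait μ lam d (meanRiderWait μ lam d) := Classical.epsilon_spec ⟨_, h⟩
  obtain ⟨ω, h1, h2⟩ := (h.and h').exists
  exact tendsto_nhds_unique h2 h1

end Means

/-! ### The deterministic optimization over load and buffer. -/

section Optimization

/-- The excess of the mean waiting time of the orders over `1 / (μ - 1)`, for the load `x` and the
buffer `n`. -/
noncomputable def excessWait (n : ℕ) (x : ℝ) : ℝ := x ^ (n + 1) / (1 - x)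

lemma excessWait_strictMono (n : ℕ) {x y : ℝ} (hx : 0 ≤ x) (hxy : x < y) (hy : y < 1) :
    excessWait n x < excessWait n y := by
  unfold excessWait
  have h1 : x ^ (n + 1) < y ^ (n + 1) := pow_lt_pow_left₀ hxy hx (Nat.succ_ne_zero n)
  have h2 : 0 ≤ x ^ (n + 1) := by positivity
  rw [div_lt_div_iff₀ (by linarith) (by linarith)]
  nlinarith

lemma excessWait_mono (n : ℕ) {x y : ℝ} (hx : 0 ≤ x) (hxy : x ≤ y) (hy : y < 1) :
    excessWait n x ≤ excessWait n y := by
  rcases hxy.eq_or_lt with rfl | h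
  · exact le_rfl
  · exact (excessWait_strictMono n hx h hy).le

lemma exists_excessWait_eq {T : ℝ} (hT : 0 < T) (n : ℕ) : ∃ x ∈ Set.Ioo (0 : ℝ) 1,
    excessWait n x = T := by
  -- Clearing the denominator avoids the pole at `1`: this polynomial is `-T` at `0` and `1` at `1`.
  have hc : ContinuousOn (fun x : ℝ => x ^ (n + 1) - T * (1 - x)) (Set.Icc 0 1) := by fun_prop
  obtain ⟨x, hx, hx0⟩ := intermediate_value_Ioo zero_le_one hc
    (show (0 : ℝ) ∈ Set.Ioo _ _ by simp [hT])
  refine ⟨x, hx, ?_⟩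
  have h1 : 0 < 1 - x := by linarith [hx.2]
  rw [excessWait, div_eq_iff h1.ne']
  simp only at hx0
  linarith

lemma isGreatest_loadSet {T : ℝ} (hT : 0 < T) (n : ℕ) :
    IsGreatest (loadSet T n) (loadGamma T n) ∧ loadGamma T n ∈ Set.Ioo (0 : ℝ) 1 ∧
      excessWait n (loadGamma T n) = T := by
  obtain ⟨x, hx, hxT⟩ := exists_excessWait_eq hT n
  have h : IsGreatest (loadSet T n) x := by
    refine ⟨⟨hx, hxT.le⟩, fun y hy => ?_⟩
    by_contra hlt
    have := excessWait_strictMono n hx.1.le (not_le.1 hlt) hy.1.2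
    exact absurd hy.2 (not_le.2 (hxT ▸ this))
  have e : loadGamma T n = x := h.csSup_eq
  rw [e]
  exact ⟨h, hx, hxT⟩

lemma isLeast_bufferSet {T ρ : ℝ} (hT : 0 < T) (h0 : 0 ≤ ρ) (h1 : ρ < 1) :
    IsLeast (bufferSet T ρ) (bufferD T ρ) := by
  have hlim : Tendsto (fun n : ℕ => ρ ^ (n + 1) / (1 - ρ)) atTop (𝓝 (0 / (1 - ρ))) :=
    ((tendsto_pow_atTop_nhds_zero_of_lt_one h0 h1).comp (tendsto_add_atTop_nat 1)).div_const _
  rw [zero_div] at hlim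
  obtain ⟨n, hn⟩ := (hlim.eventually (gt_mem_nhds hT)).exists
  have hne : (bufferSet T ρ).Nonempty := ⟨n, hn.le⟩
  exact ⟨Nat.sInf_mem hne, fun m hm => Nat.sInf_le hm⟩

/-- The mean waiting time of the riders, for the load `x` and the buffer `n`. -/
noncomputable def idleWait (n : ℕ) (x : ℝ) : ℝ := excessWait n x - x / (1 - x) + n

/-- Each unit of buffer adds `1 - x ^ (n + 1)`; in this form the monotonicity in `x` is visible. -/
lemma idleWait_eq_sum (n : ℕ) {x : ℝ} (hx : x < 1) :
    idleWait n x = ∑ i ∈ Finset.range n, (1 - x ^ (i + 1)) := by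
  have h : 1 - x ≠ 0 := by linarith
  induction n with
  | zero => simp [idleWait, excessWait]
  | succ n ih =>
    rw [Finset.sum_range_succ, ← ih, idleWait, idleWait, excessWait, excessWait]
    push_cast
    field_simp
    ring

lemma idleWait_anti (n : ℕ) {x y : ℝ} (hx : 0 ≤ x) (hxy : x ≤ y) (hy : y < 1) :
    idleWait n y ≤ idleWait n x := by
  rw [idleWait_eq_sum n hy, idleWait_eq_sum n (hxy.trans_lt hy)]
  gcongr

/-- With `x = γ(n)`, the load `z = 1 / (2 - x)` is the one with `z / (1 - z) = x / (1 - x) + 1`.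
Since `1 - z = z * (1 - x)` and `x ≤ z`, its excess for buffer `n + 1` is `z ^ (n + 1) / (1 - x) ≥
T`, so `γ(n + 1) ≤ z`. -/
lemma loadGamma_succ_le {T : ℝ} (hT : 0 < T) (n : ℕ) :
    loadGamma T (n + 1) / (1 - loadGamma T (n + 1)) ≤ loadGamma T n / (1 - loadGamma T n) + 1 := by
  obtain ⟨-, hx, hxT⟩ := isGreatest_loadSet hT n
  obtain ⟨-, hy, hyT⟩ := isGreatest_loadSet hT (n + 1)
  set x := loadGamma T n
  set y := loadGamma T (n + 1)
  have h1 : 0 < 1 - x := by linarith [hx.2]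
  have h2 : 0 < 1 - y := by linarith [hy.2]
  have h3 : 0 < 2 - x := by linarith
  have hxz : x ≤ 1 / (2 - x) := by
    rw [le_div_iff₀ h3]
    nlinarith [sq_nonneg (1 - x)]
  have hz : T ≤ excessWait (n + 1) (1 / (2 - x)) := by
    have e : excessWait (n + 1) (1 / (2 - x)) = (1 / (2 - x)) ^ (n + 1) / (1 - x) := by
      have : 1 - 1 / (2 - x) = (1 / (2 - x)) * (1 - x) := by
        field_simp
        ring
      rw [excessWait, this, pow_succ, mul_comm, mul_div_mul_left _ _ (by positivity)]
    rw [e, ← hxT, excessWait]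
    have := hx.1.le
    gcongr
  have hyz : y ≤ 1 / (2 - x) := by
    by_contra hlt
    have := excessWait_strictMono (n + 1) (by positivity) (not_le.1 hlt) hy.2
    linarith
  rw [le_div_iff₀ h3] at hyz
  rw [div_add_one h1.ne', div_le_div_iff₀ h2 h1]
  linarith

/-- On the boundary of feasibility the excess is constantly `T`, so the increase of `n` by `1`
outweighs that of `γ / (1 - γ)`. -/
lemma idleWait_loadGamma_mono {T : ℝ} (hT : 0 < T) :
    Monotone fun n => idleWait n (loadGamma T n) :=
  monotone_nat_of_le_succ fun n => by
    have h := loadGamma_succ_le hT n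
    rw [idleWait, idleWait, (isGreatest_loadSet hT n).2.2, (isGreatest_loadSet hT (n + 1)).2.2]
    push_cast
    linarith

lemma one_div_pow_div {lam : ℝ} (hl : 1 < lam) (d : ℕ) :
    (1 / lam) ^ d / (lam - 1) = excessWait d (1 / lam) := by
  have h1 : lam - 1 ≠ 0 := by linarith
  have h0 : lam ≠ 0 := by linarith
  rw [excessWait, pow_succ, one_sub_div h0]
  field_simp

lemma meanOrderWait_eq_excessWait {μ lam : ℝ} (hμ : 1 < μ) (hl : 1 < lam) (d : ℕ) :
    meanOrderWait μ lam d = 1 / (μ - 1) + excessWait d (1 / lam) := by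
  rw [meanOrderWait_eq hμ hl, one_div_pow_div hl]

lemma meanRiderWait_eq_idleWait {μ lam : ℝ} (hμ : 1 < μ) (hl : 1 < lam) (d : ℕ) :
    meanRiderWait μ lam d = idleWait d (1 / lam) := by
  have h := one_div_pow_div hl 0
  rw [excessWait, zero_add, pow_one, pow_zero] at h
  rw [meanRiderWait_eq hμ hl, one_div_pow_div hl, idleWait, ← h]
  ring

lemma feasible_iff {μ Λ T lam : ℝ} (hμ : 1 < μ) (d : ℕ) :
    Feasible μ Λ T lam d ↔ 1 < lam ∧ lam ≤ Λ ∧ excessWait d (1 / lam) ≤ T := by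
  refine and_congr_right fun hl => and_congr_right fun _ => ?_
  rw [meanOrderWait_eq_excessWait hμ hl, add_le_add_iff_left]

lemma one_div_mem_Ioo {lam : ℝ} (hl : 1 < lam) : 1 / lam ∈ Set.Ioo (0 : ℝ) 1 :=
  ⟨by positivity, by rwa [div_lt_one (by linarith)]⟩

/-- The excess increases with the load, so a buffer that works for some admissible rate works for
the smallest load `1 / Λ`. -/
lemma bufferD_le_of_feasible {μ Λ T lam : ℝ} (hμ : 1 < μ) {d : ℕ}
    (h : Feasible μ Λ T lam d) : bufferD T (1 / Λ) ≤ d := by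
  obtain ⟨hl, hlΛ, he⟩ := (feasible_iff hμ d).1 h
  have h1 : 1 / Λ ≤ 1 / lam := one_div_le_one_div_of_le (by linarith) hlΛ
  exact Nat.sInf_le ((excessWait_mono d (one_div_mem_Ioo (hl.trans_le hlΛ)).1.le h1
    (one_div_mem_Ioo hl).2).trans he)

lemma one_lt_one_div_loadGamma {T : ℝ} (hT : 0 < T) (n : ℕ) : 1 < 1 / loadGamma T n := by
  obtain ⟨-, h, -⟩ := isGreatest_loadSet hT n
  rw [lt_div_iff₀ h.1]
  linarith [h.2]

lemma feasible_loadGamma {μ Λ T : ℝ} (hμ : 1 < μ) (hΛ : 1 < Λ) (hT : 0 < T) :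
    Feasible μ Λ T (1 / loadGamma T (bufferD T (1 / Λ))) (bufferD T (1 / Λ)) := by
  set d := bufferD T (1 / Λ) with hd
  obtain ⟨hg, hx, hxT⟩ := isGreatest_loadSet hT d
  have hΛ1 := one_div_mem_Ioo hΛ
  refine (feasible_iff hμ d).2 ⟨one_lt_one_div_loadGamma hT d, ?_, ?_⟩
  · have h1 : 1 / Λ ≤ loadGamma T d := hg.2 ⟨hΛ1, (isLeast_bufferSet hT hΛ1.1.le hΛ1.2).1⟩
    rw [div_le_iff₀ (by linarith)] at h1
    rw [div_le_iff₀ hx.1]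
    linarith
  · rw [one_div_one_div, hxT]

lemma optimal_loadGamma {μ Λ T : ℝ} (hμ : 1 < μ) (hΛ : 1 < Λ) (hT : 0 < T) :
    Optimal μ Λ T (1 / loadGamma T (bufferD T (1 / Λ))) (bufferD T (1 / Λ)) := by
  refine ⟨feasible_loadGamma hμ hΛ hT, fun lam d h => ?_⟩
  have hle := bufferD_le_of_feasible hμ h
  obtain ⟨hl, -, he⟩ := (feasible_iff hμ d).1 h
  rw [meanRiderWait_eq_idleWait hμ (one_lt_one_div_loadGamma hT _),
    meanRiderWait_eq_idleWait hμ hl, one_div_one_div]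
  obtain ⟨hg, hx, -⟩ := isGreatest_loadSet hT d
  exact (idleWait_loadGamma_mono hT hle).trans
    (idleWait_anti d (one_div_mem_Ioo hl).1.le (hg.2 ⟨one_div_mem_Ioo hl, he⟩) hx.2)

lemma meanOrderWait_loadGamma {μ T : ℝ} (hμ : 1 < μ) (hT : 0 < T) (d : ℕ) :
    meanOrderWait μ (1 / loadGamma T d) d = 1 / (μ - 1) + T := by
  rw [meanOrderWait_eq_excessWait hμ (one_lt_one_div_loadGamma hT d), one_div_one_div,
    (isGreatest_loadSet hT d).2.2]

lemma isGreatest_feasible {μ Λ T : ℝ} (hμ : 1 < μ) (hΛ : 1 < Λ) (hT : 0 < T) :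
    IsGreatest {ρ : ℝ | Feasible μ Λ T (1 / ρ) (bufferD T (1 / Λ))}
      (loadGamma T (bufferD T (1 / Λ))) := by
  refine ⟨feasible_loadGamma hμ hΛ hT, fun ρ hρ => ?_⟩
  obtain ⟨hl, -, he⟩ := (feasible_iff hμ _).1 hρ
  have := one_div_mem_Ioo hl
  rw [one_div_one_div] at this he
  exact (isGreatest_loadSet hT _).1.2 ⟨this, he⟩

lemma excessWait_zero_one_div {Λ : ℝ} (hΛ : 1 < Λ) : excessWait 0 (1 / Λ) = 1 / (Λ - 1) := by
  rw [← one_div_pow_div hΛ, pow_zero]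

lemma one_div_div_one_sub {Λ : ℝ} (hΛ : 1 < Λ) : 1 / Λ / (1 - 1 / Λ) = 1 / (Λ - 1) := by
  rw [← excessWait_zero_one_div hΛ, excessWait, zero_add, pow_one]

lemma bufferD_eq_zero {Λ T : ℝ} (hΛ : 1 < Λ) (h : 1 / (Λ - 1) ≤ T) : bufferD T (1 / Λ) = 0 := by
  have : (0 : ℕ) ∈ bufferSet T (1 / Λ) := by
    rw [← excessWait_zero_one_div hΛ] at h
    exact h
  exact Nat.le_zero.1 (Nat.sInf_le this)

lemma meanRiderWait_zero {μ lam : ℝ} (hμ : 1 < μ) (hl : 1 < lam) : meanRiderWait μ lam 0 = 0 := by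
  rw [meanRiderWait_eq_idleWait hμ hl, idleWait_eq_sum 0 (one_div_mem_Ioo hl).2,
    Finset.sum_range_zero]

/-- With buffer `0` the mean wait of the riders vanishes at every rate, so `Λ` does as well as `1 /
γ(0)`. -/
lemma optimal_zero {μ Λ T : ℝ} (hμ : 1 < μ) (hΛ : 1 < Λ) (hT : 0 < T) (h : 1 / (Λ - 1) ≤ T) :
    Optimal μ Λ T Λ 0 := by
  refine ⟨(feasible_iff hμ 0).2 ⟨hΛ, le_rfl, by rwa [excessWait_zero_one_div hΛ]⟩,
    fun lam d hf => ?_⟩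
  have := (optimal_loadGamma hμ hΛ hT).2 lam d hf
  rwa [bufferD_eq_zero hΛ h, meanRiderWait_zero hμ (one_lt_one_div_loadGamma hT 0),
    ← meanRiderWait_zero hμ hΛ] at this

end Optimization
end MealDelivery

theorem mainTheorem1 (μ Λ T : ℝ) (hμ : 1 < μ) (hΛ : 1 < Λ) (hT : 0 < T) :
    -- the two long-run averages exist for every stable policy
    (∀ (lam : ℝ) (d : ℕ), 1 < lam →
      MealDelivery.IsMeanOrderWait μ lam d (MealDelivery.meanOrderWait μ lam d) ∧
      MealDelivery.IsMeanRiderWait μ lam d (MealDelivery.meanRiderWait μ lam d)) ∧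
    -- the minimum and the maxima that the algorithm refers to exist
    IsLeast (MealDelivery.bufferSet T (1 / Λ)) (MealDelivery.bufferD T (1 / Λ)) ∧
    (∀ n : ℕ, IsGreatest (MealDelivery.loadSet T n) (MealDelivery.loadGamma T n)) ∧
    -- the pair `(1 / γ(d₁), d₁)` with `d₁ = D(1 / Λ)`
    (∀ d₁ : ℕ, d₁ = MealDelivery.bufferD T (1 / Λ) →
      MealDelivery.meanOrderWait μ (1 / MealDelivery.loadGamma T d₁) d₁ = 1 / (μ - 1) + T ∧
      MealDelivery.Optimal μ Λ T (1 / MealDelivery.loadGamma T d₁) d₁ ∧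
      IsLeast {d : ℕ | ∃ lam : ℝ, MealDelivery.Feasible μ Λ T lam d} d₁ ∧
      IsGreatest {ρ : ℝ | MealDelivery.Feasible μ Λ T (1 / ρ) d₁}
        (MealDelivery.loadGamma T d₁)) ∧
    -- the pair `(λ₀, d)` returned by the algorithm, with its early exit
    (∀ (lam₀ : ℝ) (d : ℕ), (lam₀, d) = MealDelivery.dispatchAlgorithm T Λ →
      MealDelivery.Optimal μ Λ T lam₀ d ∧
      d = MealDelivery.bufferD T (1 / Λ) ∧
      (T ≤ 1 / (Λ - 1) → MealDelivery.meanOrderWait μ lam₀ d = 1 / (μ - 1) + T) ∧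
      (T < 1 / (Λ - 1) → lam₀ = 1 / MealDelivery.loadGamma T d) ∧
      (1 / (Λ - 1) ≤ T →
        lam₀ = Λ ∧ d = 0 ∧
        MealDelivery.meanOrderWait μ lam₀ d = 1 / (μ - 1) + 1 / (Λ - 1) ∧
        MealDelivery.meanRiderWait μ lam₀ d = 0)) := by
  open MealDelivery in
  refine ⟨fun lam d hl => ⟨Classical.epsilon_spec ⟨_, isMeanOrderWait hμ hl d⟩,
      Classical.epsilon_spec ⟨_, isMeanRiderWait hμ hl d⟩⟩,
    isLeast_bufferSet hT (one_div_mem_Ioo hΛ).1.le (one_div_mem_Ioo hΛ).2,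
    fun n => (isGreatest_loadSet hT n).1, ?_, ?_⟩
  · rintro d₁ rfl
    exact ⟨meanOrderWait_loadGamma hμ hT _, optimal_loadGamma hμ hΛ hT,
      ⟨⟨_, feasible_loadGamma hμ hΛ hT⟩, fun d ⟨_, h⟩ => bufferD_le_of_feasible hμ h⟩,
      isGreatest_feasible hμ hΛ hT⟩
  · intro lam₀ d h
    rw [dispatchAlgorithm, one_div_div_one_sub hΛ] at h
    split_ifs at h with hc
    · obtain ⟨rfl, rfl⟩ := Prod.mk.inj h
      have e : meanOrderWait μ lam₀ 0 = 1 / (μ - 1) + 1 / (lam₀ - 1) := by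
        rw [meanOrderWait_eq_excessWait hμ hΛ, excessWait_zero_one_div hΛ]
      refine ⟨optimal_zero hμ hΛ hT hc, (bufferD_eq_zero hΛ hc).symm, fun hle => ?_,
        fun hlt => absurd hc (not_le.2 hlt), fun _ => ⟨rfl, rfl, e, meanRiderWait_zero hμ hΛ⟩⟩
      -- The early exit meets the constraint with equality only in the boundary case `T = 1 / (Λ -
      -- 1)`.
      rw [e, le_antisymm hle hc]
    · obtain ⟨rfl, rfl⟩ := Prod.mk.inj h
      exact ⟨optimal_loadGamma hμ hΛ hT, rfl, fun _ => meanOrderWait_loadGamma hμ hT _,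
        fun _ => rfl, fun hle => absurd hle hc⟩
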